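/- Let $\mathrm{HA}^\omega$ be Heyting arithmetic in all finite types. Its types are built from $0$ (natural numbers) and the unit type $1$ by products $\rho\times\sigma$ and arrows $\rho\to\sigma$; its terms are those of the simply typed $\lambda$-calculus over these types ($\lambda$-abstraction, application, pairs $(t,s)$, projections $t_1,t_2$, the element $\mathbf 1$ of the unit type) with $0$, successor $S$ and primitive recursion into every type, taken up to $\beta\eta$-conversion and the recursor equations. Its prime formulas are the equations $t=_0s$ between terms of type $0$ and $\bot$; formulas are built by $\wedge,\vee,\to,\forall x^\rho,\exists x^\rho$, and $\neg A:=A\to\bot$. Derivability $\Gamma\vdash A$ is intuitionistic natural deduction with the axioms of equality for $=_0$ (convertible terms of type $0$ are equal; equals may be replaced by equals), $Sx=Sy\to x=y$, $Sx\neq0$, and induction for all formulas. Consider the schemata \[\mathrm{DNS}^\rho:\ \forall x^\rho\,\neg\neg A(x)\to\neg\neg\forall x^\rho A(x),\qquad \mathrm{AC}^{\rho,\sigma}:\ \forall x^\rho\exists y^\sigma A(x,y)\to\exists f^{\rho\to\sigma}\forall x^\rho A(x,f x).\] $\mathrm{AC}^\omega$ and $\mathrm{DNS}^\omega$ are these schemata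 for all $\rho,\sigma$; $\mathrm{AC}^0$ is $\mathrm{AC}^{0,\sigma}$ for all $\sigma$. A formula is arithmetical if all its quantifiers are of type $0$. Modified realizability with truth assigns to a formula $A$ and a term $t$, of a type determined by the logical form of $A$, the formula $t\ \mathsf{mrt}\ A$: \begin{align*} t\ \mathsf{mrt}\ P&:=P\quad(P\text{ prime},\ t\text{ of unit type}),\\ t\ \mathsf{mrt}\ (A\wedge B)&:=(t_1\ \mathsf{mrt}\ A)\wedge(t_2\ \mathsf{mrt}\ B),\\ t\ \mathsf{mrt}\ (A\vee B)&:=(t_2=_00\to t_{11}\ \mathsf{mrt}\ A)\wedge(t_2\neq_00\to t_{12}\ \mathsf{mrt}\ B),\\ t\ \mathsf{mrt}\ (A\to B)&:=\forall x\,(x\ \mathsf{mrt}\ A\to tx\ \mathsf{mrt}\ B)\wedge(A\to B),\\ t\ \mathsf{mrt}\ \exists y\,A(y)&:=t_1\ \mathsf{mrt}\ A(t_2),\\ t\ \mathsf{mrt}\ \forall y\,A(y)&:=\forall y\,(ty\ \mathsf{mrt}\ A(y)). \end{align*} Let $\vdash$ denote derivability in $\mathrm{HA}^\omega+\mathrm{AC}^\omega+\mathrm{DNS}^\omega$,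 or alternatively in $\mathrm{HA}^\omega+\mathrm{AC}^0+\mathrm{DNS}^0$. In either case: \begin{itemize} \item (EP) For all $\Gamma=A_1,\dots,A_k$ and every type $\tau$ and formula $A(x^\tau)$, all possibly open: if $\Gamma\vdash\exists x^\tau A(x)$, then there is a term $t$ of type $\tau$, whose free variables are among fresh variables $x_1,\dots,x_k$ and the free variables of $\Gamma$ and $\exists x^\tau A(x)$, such that $x_1\ \mathsf{mrt}\ A_1,\dots,x_k\ \mathsf{mrt}\ A_k\vdash A(t)$. \item (EP$^0$) For every closed arithmetical formula $\exists x^0A(x)$: if $\vdash\exists x^0A(x)$, then there is $n\in\mathbb N$ with $\vdash A(\overline n)$, where $\overline n=S^n0$. \item (DP$^0$) For every closed arithmetical formula $A\vee B$: if $\vdash A\vee B$, then $\vdash A$ or $\vdash B$. \item (WCR$^0$) For every closed arithmetical formula $\forall x^0\exists y^0A(x,y)$: if $\vdash\forall x^0\exists y^0A(x,y)$, then there is a total recursive function $f:\mathbb N\to\mathbb N$ such that $\vdash A(\overline n,\overline{f(n)})$ for all $n\in\mathbb N$. \end{itemize} -/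

import Mathlib

/-! Heyting arithmetic in all finite types, presented as intrinsically typed (de Bruijn) natural
deduction over a simply typed lambda calculus with arrow, product and unit types and primitive
recursion in all types; the schemata of choice and double-negation shift; and modified
realizability with truth. -/

namespace HAOmega

/-- The higher types. `nat` is the type `0`. -/
inductive Ty : Type
  | nat : Ty
  | unit : Ty
  | prod : Ty → Ty → Ty
  | arr : Ty → Ty → Ty

/-- A context lists the types of the individual variables that may occur free;
the head is the most recently bound variable. -/
abbrev Ctx := List Ty

/-- Individual variables of a given type in a context (typed de Bruijn indices). -/
inductive Var : Ctx → Ty → Type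
  | z {Δ : Ctx} {σ : Ty} : Var (σ :: Δ) σ
  | s {Δ : Ctx} {σ τ : Ty} : Var Δ σ → Var (τ :: Δ) σ

/-- Terms. `natRec a f n` is the recursor, with `f` taking the predecessor and then the
previous value. -/
inductive Tm : Ctx → Ty → Type
  | var {Δ : Ctx} {σ : Ty} : Var Δ σ → Tm Δ σ
  | lam {Δ : Ctx} {σ τ : Ty} : Tm (σ :: Δ) τ → Tm Δ (Ty.arr σ τ)
  | app {Δ : Ctx} {σ τ : Ty} : Tm Δ (Ty.arr σ τ) → Tm Δ σ → Tm Δ τ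
  | pair {Δ : Ctx} {σ τ : Ty} : Tm Δ σ → Tm Δ τ → Tm Δ (Ty.prod σ τ)
  | fst {Δ : Ctx} {σ τ : Ty} : Tm Δ (Ty.prod σ τ) → Tm Δ σ
  | snd {Δ : Ctx} {σ τ : Ty} : Tm Δ (Ty.prod σ τ) → Tm Δ τ
  | star {Δ : Ctx} : Tm Δ Ty.unit
  | zero {Δ : Ctx} : Tm Δ Ty.nat
  | succ {Δ : Ctx} : Tm Δ Ty.nat → Tm Δ Ty.nat
  | natRec {Δ : Ctx} {σ : Ty} :
      Tm Δ σ → Tm Δ (Ty.arr Ty.nat (Ty.arr σ σ)) → Tm Δ Ty.nat → Tm Δ σ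

/-- Renamings of variables. -/
abbrev Ren (Γ Δ : Ctx) := ∀ σ : Ty, Var Γ σ → Var Δ σ

/-- Extension of a renaming under a binder. -/
def Ren.lift {Γ Δ : Ctx} (r : Ren Γ Δ) (τ : Ty) : Ren (τ :: Γ) (τ :: Δ)
  | _, Var.z => Var.z
  | _, Var.s x => Var.s (r _ x)

/-- Renaming of terms. -/
def Tm.rename : {Γ Δ : Ctx} → {σ : Ty} → Ren Γ Δ → Tm Γ σ → Tm Δ σ
  | _, _, _, r, .var x => .var (r _ x)
  | _, _, _, r, .lam t => .lam (t.rename (r.lift _))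
  | _, _, _, r, .app t u => .app (t.rename r) (u.rename r)
  | _, _, _, r, .pair t u => .pair (t.rename r) (u.rename r)
  | _, _, _, r, .fst t => .fst (t.rename r)
  | _, _, _, r, .snd t => .snd (t.rename r)
  | _, _, _, _, .star => .star
  | _, _, _, _, .zero => .zero
  | _, _, _, r, .succ t => .succ (t.rename r)
  | _, _, _, r, .natRec a f n => .natRec (a.rename r) (f.rename r) (n.rename r)

/-- Weakening by one fresh variable. -/
def Tm.wk {Δ : Ctx} {σ τ : Ty} (t : Tm Δ σ) : Tm (τ :: Δ) σ :=
  t.rename fun _ x => Var.s x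

/-- Simultaneous substitutions. -/
abbrev Sub (Γ Δ : Ctx) := ∀ σ : Ty, Var Γ σ → Tm Δ σ

/-- The identity substitution. -/
def Sub.id (Δ : Ctx) : Sub Δ Δ := fun _ x => Tm.var x

/-- Extend a substitution by a term for the newest variable. -/
def Sub.cons {Γ Δ : Ctx} {τ : Ty} (t : Tm Δ τ) (s : Sub Γ Δ) : Sub (τ :: Γ) Δ
  | _, Var.z => t
  | _, Var.s x => s _ x

/-- Weaken the values of a substitution by one fresh variable. -/
def Sub.wk {Γ Δ : Ctx} (s : Sub Γ Δ) (τ : Ty) : Sub Γ (τ :: Δ) := fun _ x => (s _ x).wk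

/-- Extension of a substitution under a binder. -/
def Sub.lift {Γ Δ : Ctx} (s : Sub Γ Δ) (τ : Ty) : Sub (τ :: Γ) (τ :: Δ) :=
  Sub.cons (Tm.var Var.z) (s.wk τ)

/-- Substitution in terms. -/
def Tm.subst : {Γ Δ : Ctx} → {σ : Ty} → Sub Γ Δ → Tm Γ σ → Tm Δ σ
  | _, _, _, s, .var x => s _ x
  | _, _, _, s, .lam t => .lam (t.subst (s.lift _))
  | _, _, _, s, .app t u => .app (t.subst s) (u.subst s)
  | _, _, _, s, .pair t u => .pair (t.subst s) (u.subst s)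
  | _, _, _, s, .fst t => .fst (t.subst s)
  | _, _, _, s, .snd t => .snd (t.subst s)
  | _, _, _, _, .star => .star
  | _, _, _, _, .zero => .zero
  | _, _, _, s, .succ t => .succ (t.subst s)
  | _, _, _, s, .natRec a f n => .natRec (a.subst s) (f.subst s) (n.subst s)

/-- `t.inst u` is `t` with `u` in place of the newest variable. -/
def Tm.inst {Δ : Ctx} {σ τ : Ty} (t : Tm (τ :: Δ) σ) (u : Tm Δ τ) : Tm Δ σ :=
  t.subst (Sub.cons u (Sub.id Δ))

/-- The numeral of `n`. -/
def num {Δ : Ctx} : ℕ → Tm Δ Ty.nat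
  | 0 => .zero
  | n + 1 => .succ (num n)

/-- Conversion of terms: the least congruence containing the computation rules (beta,
projections, recursor) and the uniqueness rules of arrow, product and unit types. -/
inductive Conv : {Δ : Ctx} → {σ : Ty} → Tm Δ σ → Tm Δ σ → Prop
  | refl {Δ : Ctx} {σ : Ty} (t : Tm Δ σ) : Conv t t
  | symm {Δ : Ctx} {σ : Ty} {t u : Tm Δ σ} : Conv t u → Conv u t
  | trans {Δ : Ctx} {σ : Ty} {t u v : Tm Δ σ} : Conv t u → Conv u v → Conv t v
  | lam {Δ : Ctx} {σ τ : Ty} {t t' : Tm (σ :: Δ) τ} : Conv t t' → Conv (.lam t) (.lam t')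
  | app {Δ : Ctx} {σ τ : Ty} {t t' : Tm Δ (Ty.arr σ τ)} {u u' : Tm Δ σ} :
      Conv t t' → Conv u u' → Conv (.app t u) (.app t' u')
  | pair {Δ : Ctx} {σ τ : Ty} {t t' : Tm Δ σ} {u u' : Tm Δ τ} :
      Conv t t' → Conv u u' → Conv (.pair t u) (.pair t' u')
  | fst {Δ : Ctx} {σ τ : Ty} {t t' : Tm Δ (Ty.prod σ τ)} :
      Conv t t' → Conv (.fst t) (.fst t')
  | snd {Δ : Ctx} {σ τ : Ty} {t t' : Tm Δ (Ty.prod σ τ)} :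
      Conv t t' → Conv (.snd t) (.snd t')
  | succ {Δ : Ctx} {t t' : Tm Δ Ty.nat} : Conv t t' → Conv (.succ t) (.succ t')
  | natRec {Δ : Ctx} {σ : Ty} {a a' : Tm Δ σ} {f f' : Tm Δ (Ty.arr Ty.nat (Ty.arr σ σ))}
      {n n' : Tm Δ Ty.nat} :
      Conv a a' → Conv f f' → Conv n n' → Conv (.natRec a f n) (.natRec a' f' n')
  | beta {Δ : Ctx} {σ τ : Ty} (t : Tm (σ :: Δ) τ) (u : Tm Δ σ) :
      Conv (.app (.lam t) u) (t.inst u)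
  | eta {Δ : Ctx} {σ τ : Ty} (t : Tm Δ (Ty.arr σ τ)) :
      Conv (.lam (.app t.wk (.var .z))) t
  | fst_pair {Δ : Ctx} {σ τ : Ty} (t : Tm Δ σ) (u : Tm Δ τ) : Conv (.fst (.pair t u)) t
  | snd_pair {Δ : Ctx} {σ τ : Ty} (t : Tm Δ σ) (u : Tm Δ τ) : Conv (.snd (.pair t u)) u
  | pair_eta {Δ : Ctx} {σ τ : Ty} (t : Tm Δ (Ty.prod σ τ)) :
      Conv (.pair (.fst t) (.snd t)) t
  | unit_eta {Δ : Ctx} (t : Tm Δ Ty.unit) : Conv t .star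
  | natRec_zero {Δ : Ctx} {σ : Ty} (a : Tm Δ σ) (f : Tm Δ (Ty.arr Ty.nat (Ty.arr σ σ))) :
      Conv (.natRec a f .zero) a
  | natRec_succ {Δ : Ctx} {σ : Ty} (a : Tm Δ σ) (f : Tm Δ (Ty.arr Ty.nat (Ty.arr σ σ)))
      (n : Tm Δ Ty.nat) :
      Conv (.natRec a f (.succ n)) (.app (.app f n) (.natRec a f n))

/-- Formulas with free variables in a context. The prime formulas are the equations between
terms of type `0` and falsity. -/
inductive Fm : Ctx → Type
  | eq {Δ : Ctx} : Tm Δ Ty.nat → Tm Δ Ty.nat → Fm Δ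
  | bot {Δ : Ctx} : Fm Δ
  | and {Δ : Ctx} : Fm Δ → Fm Δ → Fm Δ
  | or {Δ : Ctx} : Fm Δ → Fm Δ → Fm Δ
  | imp {Δ : Ctx} : Fm Δ → Fm Δ → Fm Δ
  | all {Δ : Ctx} (σ : Ty) : Fm (σ :: Δ) → Fm Δ
  | ex {Δ : Ctx} (σ : Ty) : Fm (σ :: Δ) → Fm Δ

/-- Negation. -/
def Fm.neg {Δ : Ctx} (A : Fm Δ) : Fm Δ := .imp A .bot

/-- Capture-avoiding simultaneous substitution in formulas. -/
def Fm.subst : {Γ Δ : Ctx} → Sub Γ Δ → Fm Γ → Fm Δ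
  | _, _, s, .eq t u => .eq (t.subst s) (u.subst s)
  | _, _, _, .bot => .bot
  | _, _, s, .and A B => .and (A.subst s) (B.subst s)
  | _, _, s, .or A B => .or (A.subst s) (B.subst s)
  | _, _, s, .imp A B => .imp (A.subst s) (B.subst s)
  | _, _, s, .all σ A => .all σ (A.subst (s.lift σ))
  | _, _, s, .ex σ A => .ex σ (A.subst (s.lift σ))

/-- Weakening by one fresh variable. -/
def Fm.wk {Δ : Ctx} (τ : Ty) (A : Fm Δ) : Fm (τ :: Δ) := A.subst ((Sub.id Δ).wk τ)

/-- `A.inst t` is `A(t)`, where `A(x)` has the newest variable `x`. -/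
def Fm.inst {Δ : Ctx} {τ : Ty} (A : Fm (τ :: Δ)) (t : Tm Δ τ) : Fm Δ :=
  A.subst (Sub.cons t (Sub.id Δ))

/-- A formula is arithmetical if all its quantifiers have type `0`. -/
def Fm.Arithmetical : {Δ : Ctx} → Fm Δ → Prop
  | _, .eq _ _ => True
  | _, .bot => True
  | _, .and A B => A.Arithmetical ∧ B.Arithmetical
  | _, .or A B => A.Arithmetical ∧ B.Arithmetical
  | _, .imp A B => A.Arithmetical ∧ B.Arithmetical
  | _, .all σ A => σ = Ty.nat ∧ A.Arithmetical
  | _, .ex σ A => σ = Ty.nat ∧ A.Arithmetical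

/-- For `A(x)` with newest variable `x` of type `0`, the formula `A(S x)`. -/
def Fm.atSucc {Δ : Ctx} (A : Fm (Ty.nat :: Δ)) : Fm (Ty.nat :: Δ) :=
  A.subst (Sub.cons (.succ (.var .z)) ((Sub.id Δ).wk Ty.nat))

/-- The instance `∀ x^ρ ¬¬A(x) → ¬¬∀ x^ρ A(x)` of the double-negation shift. -/
def dns {Δ : Ctx} (ρ : Ty) (A : Fm (ρ :: Δ)) : Fm Δ :=
  .imp (.all ρ A.neg.neg) (Fm.all ρ A).neg.neg

/-- For `A(x,y)` with newest variable `y` and next newest `x`, the formula `A(x, f x)`,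
in which `x` is the newest variable and `f` the next newest. -/
def Fm.atApp {Δ : Ctx} {ρ σ : Ty} (A : Fm (σ :: ρ :: Δ)) : Fm (ρ :: Ty.arr ρ σ :: Δ) :=
  A.subst (Sub.cons (.app (.var (.s .z)) (.var .z))
    (Sub.cons (.var .z) (((Sub.id Δ).wk (Ty.arr ρ σ)).wk ρ)))

/-- The instance `∀ x^ρ ∃ y^σ A(x,y) → ∃ f^(ρ→σ) ∀ x^ρ A(x, f x)` of the axiom of choice. -/
def ac {Δ : Ctx} (ρ σ : Ty) (A : Fm (σ :: ρ :: Δ)) : Fm Δ :=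
  .imp (.all ρ (.ex σ A)) (.ex (Ty.arr ρ σ) (.all ρ A.atApp))

/-- `Prf R Γ A`: in Heyting arithmetic in all finite types, together with choice from type `ρ`
to every type `σ` and double-negation shift at type `ρ` for every `ρ ∈ R`, the formula `A` is
derivable from the assumptions `Γ`. -/
inductive Prf (R : Set Ty) : {Δ : Ctx} → List (Fm Δ) → Fm Δ → Prop
  | ax {Δ : Ctx} {Γ : List (Fm Δ)} {A : Fm Δ} : A ∈ Γ → Prf R Γ A
  | andI {Δ : Ctx} {Γ : List (Fm Δ)} {A B : Fm Δ} :
      Prf R Γ A → Prf R Γ B → Prf R Γ (.and A B)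
  | andE₁ {Δ : Ctx} {Γ : List (Fm Δ)} {A B : Fm Δ} : Prf R Γ (.and A B) → Prf R Γ A
  | andE₂ {Δ : Ctx} {Γ : List (Fm Δ)} {A B : Fm Δ} : Prf R Γ (.and A B) → Prf R Γ B
  | orI₁ {Δ : Ctx} {Γ : List (Fm Δ)} {A B : Fm Δ} : Prf R Γ A → Prf R Γ (.or A B)
  | orI₂ {Δ : Ctx} {Γ : List (Fm Δ)} {A B : Fm Δ} : Prf R Γ B → Prf R Γ (.or A B)
  | orE {Δ : Ctx} {Γ : List (Fm Δ)} {A B C : Fm Δ} :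
      Prf R Γ (.or A B) → Prf R (A :: Γ) C → Prf R (B :: Γ) C → Prf R Γ C
  | impI {Δ : Ctx} {Γ : List (Fm Δ)} {A B : Fm Δ} : Prf R (A :: Γ) B → Prf R Γ (.imp A B)
  | impE {Δ : Ctx} {Γ : List (Fm Δ)} {A B : Fm Δ} :
      Prf R Γ (.imp A B) → Prf R Γ A → Prf R Γ B
  | botE {Δ : Ctx} {Γ : List (Fm Δ)} {A : Fm Δ} : Prf R Γ .bot → Prf R Γ A
  | allI {Δ : Ctx} {Γ : List (Fm Δ)} {σ : Ty} {A : Fm (σ :: Δ)} :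
      Prf R (Γ.map (Fm.wk σ)) A → Prf R Γ (.all σ A)
  | allE {Δ : Ctx} {Γ : List (Fm Δ)} {σ : Ty} {A : Fm (σ :: Δ)} (t : Tm Δ σ) :
      Prf R Γ (.all σ A) → Prf R Γ (A.inst t)
  | exI {Δ : Ctx} {Γ : List (Fm Δ)} {σ : Ty} {A : Fm (σ :: Δ)} (t : Tm Δ σ) :
      Prf R Γ (A.inst t) → Prf R Γ (.ex σ A)
  | exE {Δ : Ctx} {Γ : List (Fm Δ)} {σ : Ty} {A : Fm (σ :: Δ)} {C : Fm Δ} :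
      Prf R Γ (.ex σ A) → Prf R (A :: Γ.map (Fm.wk σ)) (C.wk σ) → Prf R Γ C
  | eqConv {Δ : Ctx} {Γ : List (Fm Δ)} {t u : Tm Δ Ty.nat} : Conv t u → Prf R Γ (.eq t u)
  | eqSubst {Δ : Ctx} {Γ : List (Fm Δ)} {t u : Tm Δ Ty.nat} (A : Fm (Ty.nat :: Δ)) :
      Prf R Γ (.eq t u) → Prf R Γ (A.inst t) → Prf R Γ (A.inst u)
  | succ_inj {Δ : Ctx} {Γ : List (Fm Δ)} {t u : Tm Δ Ty.nat} :
      Prf R Γ (.eq (.succ t) (.succ u)) → Prf R Γ (.eq t u)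
  | succ_ne_zero {Δ : Ctx} {Γ : List (Fm Δ)} {t : Tm Δ Ty.nat} :
      Prf R Γ (Fm.eq (.succ t) .zero).neg
  | ind {Δ : Ctx} {Γ : List (Fm Δ)} (A : Fm (Ty.nat :: Δ)) :
      Prf R Γ (A.inst .zero) → Prf R Γ (.all Ty.nat (.imp A A.atSucc)) →
        Prf R Γ (.all Ty.nat A)
  | ac {Δ : Ctx} {Γ : List (Fm Δ)} {ρ : Ty} (σ : Ty) (A : Fm (σ :: ρ :: Δ)) :
      ρ ∈ R → Prf R Γ (ac ρ σ A)
  | dns {Δ : Ctx} {Γ : List (Fm Δ)} {ρ : Ty} (A : Fm (ρ :: Δ)) :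
      ρ ∈ R → Prf R Γ (dns ρ A)

/-- The type of the realizers of a formula. -/
def Fm.rtype : {Δ : Ctx} → Fm Δ → Ty
  | _, .eq _ _ => .unit
  | _, .bot => .unit
  | _, .and A B => .prod A.rtype B.rtype
  | _, .or A B => .prod (.prod A.rtype B.rtype) .nat
  | _, .imp A B => .arr A.rtype B.rtype
  | _, .all σ A => .arr σ A.rtype
  | _, .ex σ A => .prod A.rtype σ

/-- Modified realizability with truth: `mrt A s t` is the formula "`t` realizes `A[s]`", where
`s` is a substitution for the free variables of `A`. (Carrying `s` along lets `A(t₂)` occur in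
the clause for the existential quantifier without changing the formula recursed on.) -/
def mrt : {Γ Δ : Ctx} → (A : Fm Γ) → Sub Γ Δ → Tm Δ A.rtype → Fm Δ
  | _, _, .eq a b, s, _ => .eq (a.subst s) (b.subst s)
  | _, _, .bot, _, _ => .bot
  | _, _, .and A B, s, t => .and (mrt A s (.fst t)) (mrt B s (.snd t))
  | _, _, .or A B, s, t =>
      .and (.imp (.eq (.snd t) .zero) (mrt A s (.fst (.fst t))))
        (.imp (Fm.eq (.snd t) .zero).neg (mrt B s (.snd (.fst t))))
  | _, _, .imp A B, s, t =>
      .and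
        (.all A.rtype (.imp (mrt A (s.wk A.rtype) (.var .z))
          (mrt B (s.wk A.rtype) (.app (Tm.wk t) (.var .z)))))
        (.imp (A.subst s) (B.subst s))
  | _, _, .all σ A, s, t => .all σ (mrt A (s.lift σ) (.app (Tm.wk t) (.var .z)))
  | _, _, .ex _ A, s, t => mrt A (Sub.cons (.snd t) s) (.fst t)

/-- The context `Δ` extended by one fresh variable `x_i` for each assumption `A_i` in the list,
of the type of the realizers of `A_i`. -/
def realCtx {Δ : Ctx} : List (Fm Δ) → Ctx
  | [] => Δ
  | A :: Γ => A.rtype :: realCtx Γ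

/-- The inclusion of `Δ` in the extended context. -/
def realWk {Δ : Ctx} : (Γ : List (Fm Δ)) → Sub Δ (realCtx Γ)
  | [] => Sub.id Δ
  | A :: Γ => (realWk Γ).wk A.rtype

/-- The assumptions "`x_i` realizes `A_i`" for the fresh variables `x_i`. -/
def mrtCtx {Δ : Ctx} : (Γ : List (Fm Δ)) → List (Fm (realCtx Γ))
  | [] => []
  | A :: Γ => mrt A (realWk (A :: Γ)) (.var .z) :: (mrtCtx Γ).map (Fm.wk A.rtype)

end HAOmega

open HAOmega

/-!
Modified realizability with truth is sound: every derivable formula is realized by a term, from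
variables realizing its assumptions. The two non-constructive schemata pass through for opposite
reasons. A realizer of `∀ x ∃ y A(x,y)` already contains a choice function, so choice is realized
by projections. A negation carries no computational content: it is realized as soon as it is true,
so an instance of the double-negation shift is realized because the theory proves it.

Realizability implies truth, so the second component of a realizer of `∃ x A(x)` is a witness.
Every closed term of type `0` converts to a numeral, and a term with a free variable of type `0`
defines a recursive function; both hold because every term preserves the hereditary relation "the
number `n` codes the closed term `t`". Numerical witnesses, the decision between the two sides of
a disjunction, and recursive choice functions for closed `∀ x ∃ y A(x,y)` all follow.
-/

namespace HAOmega

variable {Γ Δ Ξ : Ctx} {ρ σ τ : Ty}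

/-! ### Substitution -/

theorem Ren.lift_comp (r : Ren Γ Δ) (r' : Ren Δ Ξ) (τ : Ty) :
    (fun σ x => r'.lift τ σ (r.lift τ σ x)) = Ren.lift (fun σ x => r' σ (r σ x)) τ := by
  funext σ x; cases x <;> rfl

theorem Tm.rename_rename (t : Tm Γ σ) (r : Ren Γ Δ) (r' : Ren Δ Ξ) :
    (t.rename r).rename r' = t.rename fun σ x => r' σ (r σ x) := by
  induction t generalizing Δ Ξ <;> simp_all only [Tm.rename, Ren.lift_comp]

theorem Sub.lift_ren_comp (r : Ren Γ Δ) (s : Sub Δ Ξ) (τ : Ty) :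
    (fun σ x => s.lift τ σ (r.lift τ σ x)) = Sub.lift (fun σ x => s σ (r σ x)) τ := by
  funext σ x; cases x <;> rfl

theorem Tm.subst_rename (t : Tm Γ σ) (r : Ren Γ Δ) (s : Sub Δ Ξ) :
    (t.rename r).subst s = t.subst fun σ x => s σ (r σ x) := by
  induction t generalizing Δ Ξ <;> simp_all only [Tm.rename, Tm.subst, Sub.lift_ren_comp]

theorem Sub.lift_comp_ren (s : Sub Γ Δ) (r : Ren Δ Ξ) (τ : Ty) :
    (fun σ x => (s.lift τ σ x).rename (r.lift τ)) =
      Sub.lift (fun σ x => (s σ x).rename r) τ := by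
  funext σ x
  cases x with
  | z => rfl
  | s x => simp only [Sub.lift, Sub.cons, Sub.wk, Tm.wk, Tm.rename_rename]; rfl

theorem Tm.rename_subst (t : Tm Γ σ) (s : Sub Γ Δ) (r : Ren Δ Ξ) :
    (t.subst s).rename r = t.subst fun σ x => (s σ x).rename r := by
  induction t generalizing Δ Ξ <;> simp_all only [Tm.rename, Tm.subst, Sub.lift_comp_ren]

/-- Composition of substitutions, in diagrammatic order: first `s`, then `θ`. -/
def Sub.comp (s : Sub Γ Δ) (θ : Sub Δ Ξ) : Sub Γ Ξ := fun _ x => (s _ x).subst θ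

theorem Sub.lift_comp (s : Sub Γ Δ) (θ : Sub Δ Ξ) (τ : Ty) :
    (s.comp θ).lift τ = (s.lift τ).comp (θ.lift τ) := by
  funext σ x
  cases x with
  | z => rfl
  | s x =>
    simp only [Sub.comp, Sub.lift, Sub.cons, Sub.wk, Tm.wk, Tm.rename_subst, Tm.subst_rename]

theorem Tm.subst_subst (t : Tm Γ σ) (s : Sub Γ Δ) (θ : Sub Δ Ξ) :
    (t.subst s).subst θ = t.subst (s.comp θ) := by
  induction t generalizing Δ Ξ with
  | var => rfl
  | _ => simp_all only [Tm.subst, Sub.lift_comp]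

@[simp] theorem Sub.id_lift (Δ : Ctx) (τ : Ty) : (Sub.id Δ).lift τ = Sub.id (τ :: Δ) := by
  funext σ x; cases x <;> rfl

@[simp] theorem Tm.subst_id (t : Tm Γ σ) : t.subst (Sub.id Γ) = t := by
  induction t with
  | var => rfl
  | _ => simp_all only [Tm.subst, Sub.id_lift]

theorem Tm.wk_eq_subst (t : Tm Δ σ) (τ : Ty) :
    (t.wk : Tm (τ :: Δ) σ) = t.subst ((Sub.id Δ).wk τ) := by
  rw [← Tm.subst_id t.wk, Tm.wk, Tm.subst_rename]; rfl

@[simp] theorem Tm.subst_cons_wk (t : Tm Γ σ) (u : Tm Δ τ) (s : Sub Γ Δ) :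
    t.wk.subst (Sub.cons u s) = t.subst s :=
  t.subst_rename _ _

theorem Tm.subst_wk (t : Tm Γ σ) (s : Sub Γ Δ) (τ : Ty) :
    t.subst (s.wk τ) = (t.subst s).wk :=
  (t.rename_subst _ _).symm

@[simp] theorem Tm.subst_lift_wk (t : Tm Γ σ) (s : Sub Γ Δ) (τ : Ty) :
    t.wk.subst (s.lift τ) = (t.subst s).wk := by
  rw [Sub.lift, Tm.subst_cons_wk, Tm.subst_wk]

@[simp] theorem Sub.cons_comp (t : Tm Δ τ) (s : Sub Γ Δ) (θ : Sub Δ Ξ) :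
    (Sub.cons t s).comp θ = Sub.cons (t.subst θ) (s.comp θ) := by
  funext σ x; cases x <;> rfl

@[simp] theorem Sub.id_comp (s : Sub Γ Δ) : (Sub.id Γ).comp s = s := rfl

@[simp] theorem Sub.comp_id (s : Sub Γ Δ) : s.comp (Sub.id Δ) = s := by
  funext σ x; exact Tm.subst_id _

@[simp] theorem Sub.wk_comp_cons (s : Sub Γ Δ) (t : Tm Ξ τ) (θ : Sub Δ Ξ) :
    (s.wk τ).comp (Sub.cons t θ) = s.comp θ := by
  funext σ x; exact Tm.subst_cons_wk _ _ _

theorem Sub.comp_wk (s : Sub Γ Δ) (θ : Sub Δ Ξ) (τ : Ty) :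
    s.comp (θ.wk τ) = (s.comp θ).wk τ := by
  funext σ x; exact Tm.subst_wk _ _ _

@[simp] theorem Sub.wk_comp_lift (s : Sub Γ Δ) (θ : Sub Δ Ξ) :
    (s.wk τ).comp (θ.lift τ) = (s.comp θ).wk τ := by
  rw [Sub.lift, Sub.wk_comp_cons, Sub.comp_wk]

@[simp] theorem Sub.lift_comp_cons (s : Sub Γ Δ) (t : Tm Ξ τ) (θ : Sub Δ Ξ) :
    (s.lift τ).comp (Sub.cons t θ) = Sub.cons t (s.comp θ) := by
  rw [Sub.lift, Sub.cons_comp, Sub.wk_comp_cons]; rfl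

@[simp] theorem Sub.wk_lift_comp_cons_var (s : Sub Γ Δ) (τ : Ty) :
    ((s.wk τ).lift τ).comp (Sub.cons (.var .z) (Sub.id (τ :: Δ))) = s.lift τ := by
  rw [Sub.lift_comp_cons, Sub.comp_id]; rfl

@[simp] theorem Tm.inst_wk (t : Tm Δ σ) (u : Tm Δ τ) : t.wk.inst u = t := by
  rw [Tm.inst, Tm.subst_cons_wk, Tm.subst_id]

theorem Tm.inst_subst_lift (t : Tm (τ :: Γ) σ) (s : Sub Γ Δ) (u : Tm Δ τ) :
    (t.subst (s.lift τ)).inst u = t.subst (Sub.cons u s) := by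
  rw [Tm.inst, Tm.subst_subst, Sub.lift_comp_cons, Sub.comp_id]

theorem Tm.subst_inst (t : Tm (τ :: Γ) σ) (u : Tm Γ τ) (s : Sub Γ Δ) :
    (t.inst u).subst s = (t.subst (s.lift τ)).inst (u.subst s) := by
  rw [Tm.inst, Tm.subst_subst, Sub.cons_comp, Sub.id_comp, Tm.inst_subst_lift]

@[simp] theorem num_subst (s : Sub Γ Δ) (n : ℕ) : (num n).subst s = num n := by
  induction n <;> simp_all only [num, Tm.subst]

theorem Fm.subst_subst (A : Fm Γ) (s : Sub Γ Δ) (θ : Sub Δ Ξ) :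
    (A.subst s).subst θ = A.subst (s.comp θ) := by
  induction A generalizing Δ Ξ <;> simp_all only [Fm.subst, Tm.subst_subst, Sub.lift_comp]

@[simp] theorem Fm.subst_id (A : Fm Γ) : A.subst (Sub.id Γ) = A := by
  induction A <;> simp_all only [Fm.subst, Tm.subst_id, Sub.id_lift]

@[simp] theorem Fm.subst_cons_wk (A : Fm Γ) (u : Tm Δ τ) (s : Sub Γ Δ) :
    (A.wk τ).subst (Sub.cons u s) = A.subst s := by
  rw [Fm.wk, Fm.subst_subst, Sub.wk_comp_cons, Sub.id_comp]

theorem Fm.subst_wk (A : Fm Γ) (s : Sub Γ Δ) (τ : Ty) :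
    A.subst (s.wk τ) = (A.subst s).wk τ := by
  rw [Fm.wk, Fm.subst_subst, Sub.comp_wk, Sub.comp_id]

@[simp] theorem Fm.subst_lift_wk (A : Fm Γ) (s : Sub Γ Δ) :
    (A.wk τ).subst (s.lift τ) = (A.subst s).wk τ := by
  rw [Sub.lift, Fm.subst_cons_wk, Fm.subst_wk]

theorem Fm.map_subst_lift_wk (L : List (Fm Γ)) (s : Sub Γ Δ) (τ : Ty) :
    (L.map (Fm.wk τ)).map (Fm.subst (s.lift τ)) = (L.map (Fm.subst s)).map (Fm.wk τ) := by
  simp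

@[simp] theorem Fm.inst_wk (A : Fm Δ) (u : Tm Δ τ) : (A.wk τ).inst u = A := by
  rw [Fm.inst, Fm.subst_cons_wk, Fm.subst_id]

theorem Fm.inst_subst_lift (A : Fm (τ :: Γ)) (s : Sub Γ Δ) (u : Tm Δ τ) :
    (A.subst (s.lift τ)).inst u = A.subst (Sub.cons u s) := by
  rw [Fm.inst, Fm.subst_subst, Sub.lift_comp_cons, Sub.comp_id]

theorem Fm.subst_inst (A : Fm (τ :: Γ)) (u : Tm Γ τ) (s : Sub Γ Δ) :
    (A.inst u).subst s = (A.subst (s.lift τ)).inst (u.subst s) := by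
  rw [Fm.inst, Fm.subst_subst, Sub.cons_comp, Sub.id_comp, Fm.inst_subst_lift]

theorem Fm.atSucc_subst (A : Fm (Ty.nat :: Γ)) (s : Sub Γ Δ) :
    A.atSucc.subst (s.lift Ty.nat) = (A.subst (s.lift Ty.nat)).atSucc := by
  simp only [Fm.atSucc, Fm.subst_subst, Sub.cons_comp, Sub.wk_comp_lift, Sub.lift_comp_cons,
    Sub.id_comp, Sub.comp_wk, Sub.comp_id, Tm.subst]
  rfl

theorem Fm.atApp_subst (A : Fm (σ :: ρ :: Γ)) (s : Sub Γ Δ) :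
    A.atApp.subst ((s.lift (Ty.arr ρ σ)).lift ρ) = (A.subst ((s.lift ρ).lift σ)).atApp := by
  simp only [Fm.atApp, Fm.subst_subst, Sub.cons_comp, Sub.wk_comp_lift, Sub.lift_comp_cons,
    Sub.id_comp, Sub.comp_wk, Sub.comp_id, Tm.subst]
  rfl

theorem ac_subst (A : Fm (σ :: ρ :: Γ)) (s : Sub Γ Δ) :
    (ac ρ σ A).subst s = ac ρ σ (A.subst ((s.lift ρ).lift σ)) := by
  simp only [ac, Fm.subst, Fm.atApp_subst]

theorem dns_subst (A : Fm (ρ :: Γ)) (s : Sub Γ Δ) :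
    (dns ρ A).subst s = dns ρ (A.subst (s.lift ρ)) := rfl

/-! ### Conversion -/

theorem Conv.of_eq {t u : Tm Δ σ} (h : t = u) : Conv t u := h ▸ Conv.refl t

theorem Conv.subst {t u : Tm Γ σ} (h : Conv t u) (s : Sub Γ Δ) :
    Conv (t.subst s) (u.subst s) := by
  induction h generalizing Δ with
  | refl => exact .refl _
  | symm _ ih => exact (ih s).symm
  | trans _ _ ih₁ ih₂ => exact (ih₁ s).trans (ih₂ s)
  | lam _ ih => exact .lam (ih _)
  | app _ _ ih₁ ih₂ => exact .app (ih₁ s) (ih₂ s)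
  | pair _ _ ih₁ ih₂ => exact .pair (ih₁ s) (ih₂ s)
  | fst _ ih => exact .fst (ih s)
  | snd _ ih => exact .snd (ih s)
  | succ _ ih => exact .succ (ih s)
  | natRec _ _ _ ih₁ ih₂ ih₃ => exact .natRec (ih₁ s) (ih₂ s) (ih₃ s)
  | beta t u => rw [Tm.subst_inst]; exact .beta _ _
  | eta t => simp only [Tm.subst, Tm.subst_lift_wk]; exact .eta _
  | fst_pair => exact .fst_pair _ _
  | snd_pair => exact .snd_pair _ _
  | pair_eta => exact .pair_eta _
  | unit_eta => exact .unit_eta _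
  | natRec_zero => exact .natRec_zero _ _
  | natRec_succ => exact .natRec_succ _ _ _

theorem Conv.wk {t u : Tm Δ σ} (h : Conv t u) (τ : Ty) : Conv (t.wk : Tm (τ :: Δ) σ) u.wk := by
  rw [Tm.wk_eq_subst, Tm.wk_eq_subst]; exact h.subst _

theorem Conv.app_lam_wk (t : Tm (σ :: Δ) τ) :
    Conv (.app (Tm.wk (.lam t)) (.var .z)) t := by
  rw [Tm.wk_eq_subst]
  refine (Conv.beta _ _).trans (.of_eq ?_)
  rw [Tm.inst, Tm.subst_subst, Sub.wk_lift_comp_cons_var, Sub.id_lift, Tm.subst_id]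

/-- Pointwise convertibility of substitutions. -/
def Sub.Convertible (s s' : Sub Γ Δ) : Prop := ∀ σ x, Conv (s σ x) (s' σ x)

theorem Sub.Convertible.refl (s : Sub Γ Δ) : s.Convertible s := fun _ _ => .refl _

theorem Sub.Convertible.wk {s s' : Sub Γ Δ} (h : s.Convertible s') (τ : Ty) :
    (s.wk τ).Convertible (s'.wk τ) := fun _ x => (h _ x).wk τ

theorem Sub.Convertible.cons {s s' : Sub Γ Δ} {t t' : Tm Δ τ} (ht : Conv t t')
    (h : s.Convertible s') : (Sub.cons t s).Convertible (Sub.cons t' s')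
  | _, .z => ht
  | _, .s x => h _ x

theorem Sub.Convertible.lift {s s' : Sub Γ Δ} (h : s.Convertible s') (τ : Ty) :
    (s.lift τ).Convertible (s'.lift τ) := .cons (.refl _) (h.wk τ)

theorem Sub.Convertible.subst {s s' : Sub Γ Δ} (h : s.Convertible s') (t : Tm Γ σ) :
    Conv (t.subst s) (t.subst s') := by
  induction t generalizing Δ with
  | var x => exact h _ x
  | lam _ ih => exact .lam (ih (h.lift _))
  | app _ _ ih₁ ih₂ => exact .app (ih₁ h) (ih₂ h)
  | pair _ _ ih₁ ih₂ => exact .pair (ih₁ h) (ih₂ h)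
  | fst _ ih => exact .fst (ih h)
  | snd _ ih => exact .snd (ih h)
  | star => exact .refl _
  | zero => exact .refl _
  | succ _ ih => exact .succ (ih h)
  | natRec _ _ _ ih₁ ih₂ ih₃ => exact .natRec (ih₁ h) (ih₂ h) (ih₃ h)

variable {R : Set Ty} {L L' : List (Fm Δ)} {A B : Fm Δ}

/-! ### Derivability -/

theorem Prf.subst_weaken {L : List (Fm Γ)} {A : Fm Γ} (h : Prf R L A) (s : Sub Γ Δ)
    {L' : List (Fm Δ)} (hL : L.map (Fm.subst s) ⊆ L') : Prf R L' (A.subst s) := by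
  induction h generalizing Δ with
  | ax h => exact .ax (hL (List.mem_map_of_mem h))
  | andI _ _ ih₁ ih₂ => exact .andI (ih₁ s hL) (ih₂ s hL)
  | andE₁ _ ih => exact .andE₁ (ih s hL)
  | andE₂ _ ih => exact .andE₂ (ih s hL)
  | orI₁ _ ih => exact .orI₁ (ih s hL)
  | orI₂ _ ih => exact .orI₂ (ih s hL)
  | orE _ _ _ ih ih₁ ih₂ =>
    exact .orE (ih s hL) (ih₁ s (List.cons_subset_cons _ hL))
      (ih₂ s (List.cons_subset_cons _ hL))
  | impI _ ih => exact .impI (ih s (List.cons_subset_cons _ hL))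
  | impE _ _ ih₁ ih₂ => exact .impE (ih₁ s hL) (ih₂ s hL)
  | botE _ ih => exact .botE (ih s hL)
  | allI _ ih =>
    exact .allI (ih (s.lift _) (Fm.map_subst_lift_wk _ s _ ▸ List.map_subset _ hL))
  | allE t _ ih => rw [Fm.subst_inst]; exact .allE _ (ih s hL)
  | exI t _ ih => exact .exI (t.subst s) (Fm.subst_inst _ t s ▸ ih s hL)
  | exE _ _ ih₁ ih₂ =>
    refine .exE (ih₁ s hL) ?_
    rw [← Fm.subst_lift_wk]
    exact ih₂ (s.lift _)
      (List.cons_subset_cons _ (Fm.map_subst_lift_wk _ s _ ▸ List.map_subset _ hL))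
  | eqConv h => exact .eqConv (h.subst s)
  | eqSubst A _ _ ih₁ ih₂ =>
    rw [Fm.subst_inst]
    exact .eqSubst _ (ih₁ s hL) (Fm.subst_inst A _ s ▸ ih₂ s hL)
  | succ_inj _ ih => exact .succ_inj (ih s hL)
  | succ_ne_zero => exact .succ_ne_zero
  | ind A _ _ ih₁ ih₂ =>
    refine .ind _ (Fm.subst_inst A .zero s ▸ ih₁ s hL :) ?_
    rw [← Fm.atSucc_subst]
    exact ih₂ s hL
  | ac σ A h => rw [ac_subst]; exact .ac _ _ h
  | dns A h => rw [dns_subst]; exact .dns _ h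

theorem Prf.subst {L : List (Fm Γ)} {A : Fm Γ} (h : Prf R L A) (s : Sub Γ Δ) :
    Prf R (L.map (Fm.subst s)) (A.subst s) :=
  h.subst_weaken s (List.Subset.refl _)

theorem Prf.wk (h : Prf R L A) (τ : Ty) : Prf R (L.map (Fm.wk τ)) (A.wk τ) := h.subst _

theorem Prf.weaken (h : Prf R L A) (hL : L ⊆ L') : Prf R L' A := by
  have map_id : L.map (Fm.subst (Sub.id Δ)) = L :=
    (List.map_congr_left fun B _ => B.subst_id).trans L.map_id
  simpa only [Fm.subst_id] using h.subst_weaken (Sub.id Δ) (by rwa [map_id])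

theorem Prf.weaken_cons (h : Prf R L A) (B : Fm Δ) : Prf R (B :: L) A :=
  h.weaken (List.subset_cons_self _ _)

theorem Prf.cut (h : Prf R L A) (hL : ∀ B ∈ L, Prf R L' B) : Prf R L' A := by
  induction L generalizing A with
  | nil => exact h.weaken (List.nil_subset _)
  | cons B L ih =>
    rw [List.forall_mem_cons] at hL
    exact .impE (ih (.impI h) hL.2) hL.1

theorem Prf.hyp : Prf R (A :: L) A := .ax List.mem_cons_self

theorem Prf.all_open {A : Fm (σ :: Δ)} (h : Prf R L (.all σ A)) :
    Prf R (L.map (Fm.wk σ)) A := by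
  have := Prf.allE (.var .z) (h.wk σ)
  rwa [Fm.inst, Fm.subst_subst, Sub.wk_lift_comp_cons_var, Sub.id_lift, Fm.subst_id] at this

theorem Prf.eq_trans {t u v : Tm Δ Ty.nat} (h : Prf R L (.eq t u)) (h' : Prf R L (.eq u v)) :
    Prf R L (.eq t v) := by
  have hA (w : Tm Δ Ty.nat) : (Fm.eq t.wk (.var .z)).inst w = .eq t w := by
    simp [Fm.inst, Fm.subst, Tm.subst, Sub.cons]
  exact hA v ▸ .eqSubst _ h' (hA u ▸ h)

theorem Prf.nat_cases (A : Fm (Ty.nat :: Δ)) (t : Tm Δ Ty.nat) (h₀ : Prf R L (A.inst .zero))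
    (h₁ : Prf R (L.map (Fm.wk Ty.nat)) A.atSucc) : Prf R L (A.inst t) :=
  .allE t (.ind A h₀ (.allI (.impI (h₁.weaken_cons _))))

/-- The formulas `A` and `B` are interderivable: they follow from the same assumptions. -/
def Fm.Equiv (R : Set Ty) (A B : Fm Δ) : Prop := ∀ L : List (Fm Δ), Prf R L A ↔ Prf R L B

namespace Fm.Equiv

theorem symm (h : A.Equiv R B) : B.Equiv R A := fun L => (h L).symm

theorem eq {t t' u u' : Tm Δ Ty.nat} (ht : Conv t t') (hu : Conv u u') :
    (Fm.eq t u).Equiv R (Fm.eq t' u') := fun _ =>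
  ⟨fun h => (Prf.eqConv ht.symm).eq_trans (h.eq_trans (.eqConv hu)),
    fun h => (Prf.eqConv ht).eq_trans (h.eq_trans (.eqConv hu.symm))⟩

theorem bot : (Fm.bot : Fm Δ).Equiv R Fm.bot := fun _ => Iff.rfl

variable {A' B' : Fm Δ}

theorem and (hA : A.Equiv R A') (hB : B.Equiv R B') :
    (Fm.and A B).Equiv R (Fm.and A' B') := fun _ =>
  ⟨fun h => .andI ((hA _).1 h.andE₁) ((hB _).1 h.andE₂),
    fun h => .andI ((hA _).2 h.andE₁) ((hB _).2 h.andE₂)⟩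

theorem or (hA : A.Equiv R A') (hB : B.Equiv R B') :
    (Fm.or A B).Equiv R (Fm.or A' B') := fun _ =>
  ⟨fun h => .orE h (.orI₁ ((hA _).1 .hyp)) (.orI₂ ((hB _).1 .hyp)),
    fun h => .orE h (.orI₁ ((hA _).2 .hyp)) (.orI₂ ((hB _).2 .hyp))⟩

theorem imp (hA : A.Equiv R A') (hB : B.Equiv R B') :
    (Fm.imp A B).Equiv R (Fm.imp A' B') := fun _ =>
  ⟨fun h => .impI ((hB _).1 (.impE (h.weaken_cons _) ((hA _).2 .hyp))),
    fun h => .impI ((hB _).2 (.impE (h.weaken_cons _) ((hA _).1 .hyp)))⟩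

theorem all {A A' : Fm (σ :: Δ)} (hA : A.Equiv R A') :
    (Fm.all σ A).Equiv R (Fm.all σ A') := fun _ =>
  ⟨fun h => .allI ((hA _).1 h.all_open), fun h => .allI ((hA _).2 h.all_open)⟩

theorem ex {A A' : Fm (σ :: Δ)} (hA : A.Equiv R A') : (Fm.ex σ A).Equiv R (Fm.ex σ A') := by
  have ex_mono {A A' : Fm (σ :: Δ)} (hA : A.Equiv R A') {L : List (Fm Δ)}
      (h : Prf R L (.ex σ A)) : Prf R L (.ex σ A') := by
    refine .exE h (.exI (.var .z) ?_)
    rw [Fm.inst, Fm.subst_subst, Sub.wk_lift_comp_cons_var, Sub.id_lift, Fm.subst_id]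
    exact (hA _).1 .hyp
  exact fun _ => ⟨ex_mono hA, ex_mono hA.symm⟩

end Fm.Equiv

theorem Sub.Convertible.equiv {s s' : Sub Γ Δ} (h : s.Convertible s') (A : Fm Γ) :
    (A.subst s).Equiv R (A.subst s') := by
  induction A generalizing Δ with
  | eq t u => exact .eq (h.subst t) (h.subst u)
  | bot => exact .bot
  | and _ _ ih₁ ih₂ => exact .and (ih₁ h) (ih₂ h)
  | or _ _ ih₁ ih₂ => exact .or (ih₁ h) (ih₂ h)
  | imp _ _ ih₁ ih₂ => exact .imp (ih₁ h) (ih₂ h)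
  | all _ _ ih => exact .all (ih (h.lift _))
  | ex _ _ ih => exact .ex (ih (h.lift _))

theorem Prf.inst_conv {A : Fm (σ :: Δ)} {t u : Tm Δ σ} (h : Prf R L (A.inst t))
    (htu : Conv t u) : Prf R L (A.inst u) :=
  ((Sub.Convertible.cons htu (.refl _)).equiv A L).1 h

/-! ### Realizability and substitution -/

theorem mrt_equiv (A : Fm Γ) {s s' : Sub Γ Δ} {t t' : Tm Δ A.rtype} (hs : s.Convertible s')
    (ht : Conv t t') : (mrt A s t).Equiv R (mrt A s' t') := by
  induction A generalizing Δ with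
  | eq a b => exact .eq (hs.subst a) (hs.subst b)
  | bot => exact .bot
  | and _ _ ih₁ ih₂ => exact .and (ih₁ hs ht.fst) (ih₂ hs ht.snd)
  | or _ _ ih₁ ih₂ =>
    exact .and (.imp (.eq ht.snd (.refl _)) (ih₁ hs ht.fst.fst))
      (.imp (.imp (.eq ht.snd (.refl _)) .bot) (ih₂ hs ht.fst.snd))
  | imp A B ih₁ ih₂ =>
    exact .and (.all (.imp (ih₁ (hs.wk _) (.refl _)) (ih₂ (hs.wk _) ((ht.wk _).app (.refl _)))))
      (.imp (hs.equiv A) (hs.equiv B))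
  | all _ _ ih => exact .all (ih (hs.lift _) ((ht.wk _).app (.refl _)))
  | ex _ _ ih => exact ih (.cons ht.snd hs) ht.fst

theorem Prf.mrt_conv {A : Fm Γ} {s : Sub Γ Δ} {t t' : Tm Δ A.rtype}
    (h : Prf R L (mrt A s t)) (ht : Conv t t') : Prf R L (mrt A s t') :=
  (mrt_equiv A (.refl s) ht L).1 h

theorem subst_mrt (A : Fm Γ) (s : Sub Γ Δ) (t : Tm Δ A.rtype) (θ : Sub Δ Ξ) :
    (mrt A s t).subst θ = mrt A (s.comp θ) (t.subst θ) := by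
  induction A generalizing Δ Ξ with
  | eq => simp only [mrt, Fm.subst, Tm.subst_subst]
  | bot => rfl
  | and _ _ ih₁ ih₂ => exact congrArg₂ Fm.and (ih₁ s _ θ) (ih₂ s _ θ)
  | or _ _ ih₁ ih₂ =>
    exact congrArg₂ Fm.and (congrArg (Fm.imp _) (ih₁ s _ θ)) (congrArg (Fm.imp _) (ih₂ s _ θ))
  | imp A B ih₁ ih₂ =>
    have hs := Sub.wk_comp_lift (τ := A.rtype) s θ
    have ht := congrArg (Tm.app · (.var .z)) (Tm.subst_lift_wk t θ A.rtype)
    exact congrArg₂ Fm.and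
      (congrArg (Fm.all _) (congrArg₂ Fm.imp ((ih₁ _ _ _).trans (congrArg (mrt A · _) hs))
        ((ih₂ _ _ _).trans (congrArg₂ (mrt B) hs ht))))
      (congrArg₂ Fm.imp (A.subst_subst s θ) (B.subst_subst s θ))
  | all σ A ih =>
    have ht := congrArg (Tm.app · (.var .z)) (Tm.subst_lift_wk t θ σ)
    exact congrArg (Fm.all σ) ((ih _ _ _).trans (congrArg₂ (mrt A) (Sub.lift_comp s θ σ).symm ht))
  | ex σ A ih => exact (ih _ _ _).trans (congrArg (mrt A · _) (Sub.cons_comp _ s θ))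

theorem wk_mrt (A : Fm Γ) (s : Sub Γ Δ) (t : Tm Δ A.rtype) (τ : Ty) :
    (mrt A s t).wk τ = mrt A (s.wk τ) t.wk := by
  rw [Fm.wk, subst_mrt, Sub.comp_wk, Sub.comp_id, ← Tm.wk_eq_subst]

theorem inst_mrt_wk (A : Fm Γ) (s : Sub Γ Δ) (t : Tm (τ :: Δ) A.rtype) (u : Tm Δ τ) :
    (mrt A (s.wk τ) t).inst u = mrt A s (t.inst u) := by
  rw [Fm.inst, subst_mrt, Sub.wk_comp_cons, Sub.comp_id, Tm.inst]

theorem inst_mrt_lift (A : Fm (τ :: Γ)) (s : Sub Γ Δ) (t : Tm (τ :: Δ) A.rtype) (u : Tm Δ τ) :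
    (mrt A (s.lift τ) t).inst u = mrt A (Sub.cons u s) (t.inst u) := by
  rw [Fm.inst, subst_mrt, Sub.lift_comp_cons, Sub.comp_id, Tm.inst]

/-- For a term `t(x)` with newest variable `x` of type `0`, the term `t(S x)`; the counterpart
for terms of `Fm.atSucc`. -/
def Tm.atSucc (t : Tm (Ty.nat :: Δ) σ) : Tm (Ty.nat :: Δ) σ :=
  t.subst (Sub.cons (.succ (.var .z)) ((Sub.id Δ).wk Ty.nat))

theorem atSucc_mrt_wk (A : Fm Γ) (s : Sub Γ Δ) (t : Tm (Ty.nat :: Δ) A.rtype) :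
    (mrt A (s.wk Ty.nat) t).atSucc = mrt A (s.wk Ty.nat) t.atSucc := by
  rw [Fm.atSucc, subst_mrt, Sub.wk_comp_cons, Sub.comp_wk, Sub.comp_id, Tm.atSucc]

theorem atSucc_mrt_lift (A : Fm (Ty.nat :: Γ)) (s : Sub Γ Δ) (t : Tm (Ty.nat :: Δ) A.rtype) :
    (mrt A (s.lift Ty.nat) t).atSucc =
      mrt A (Sub.cons (.succ (.var .z)) (s.wk Ty.nat)) t.atSucc := by
  rw [Fm.atSucc, subst_mrt, Sub.lift_comp_cons, Sub.comp_wk, Sub.comp_id, Tm.atSucc]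

theorem Fm.rtype_subst (A : Fm Γ) (s : Sub Γ Δ) : (A.subst s).rtype = A.rtype := by
  induction A generalizing Δ <;> simp_all only [Fm.subst, Fm.rtype]

variable {σ' τ' : Ty}

theorem Tm.fst_heq (hσ : σ = σ') (hτ : τ = τ') {t : Tm Δ (.prod σ τ)} {t' : Tm Δ (.prod σ' τ')}
    (h : t ≍ t') : Tm.fst t ≍ Tm.fst t' := by
  subst hσ hτ; rw [eq_of_heq h]

theorem Tm.snd_heq (hσ : σ = σ') (hτ : τ = τ') {t : Tm Δ (.prod σ τ)} {t' : Tm Δ (.prod σ' τ')}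
    (h : t ≍ t') : Tm.snd t ≍ Tm.snd t' := by
  subst hσ hτ; rw [eq_of_heq h]

theorem Tm.app_wk_heq (hτ : τ = τ') {t : Tm Δ (.arr σ τ)} {t' : Tm Δ (.arr σ τ')}
    (h : t ≍ t') :
    Tm.app t.wk (.var (.z : Var (σ :: Δ) σ)) ≍ Tm.app t'.wk (.var (.z : Var (σ :: Δ) σ)) := by
  subst hτ; rw [eq_of_heq h]

theorem Fm.all_imp_congr_of_heq (hσ : σ = σ') (hτ : τ = τ') {θ : ∀ ρ, Sub Γ (ρ :: Δ)}
    {F : ∀ {Ξ : Ctx}, Sub Γ Ξ → Tm Ξ σ → Fm Ξ} {F' : ∀ {Ξ : Ctx}, Sub Γ Ξ → Tm Ξ σ' → Fm Ξ}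
    {G : ∀ {Ξ : Ctx}, Sub Γ Ξ → Tm Ξ τ → Fm Ξ} {G' : ∀ {Ξ : Ctx}, Sub Γ Ξ → Tm Ξ τ' → Fm Ξ}
    (hF : ∀ {Ξ : Ctx} (η : Sub Γ Ξ) {u : Tm Ξ σ} {u' : Tm Ξ σ'}, u ≍ u' → F η u = F' η u')
    (hG : ∀ {Ξ : Ctx} (η : Sub Γ Ξ) {u : Tm Ξ τ} {u' : Tm Ξ τ'}, u ≍ u' → G η u = G' η u')
    {t : Tm Δ (.arr σ τ)} {t' : Tm Δ (.arr σ' τ')} (h : t ≍ t') :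
    Fm.all σ (.imp (F (θ σ) (.var .z)) (G (θ σ) (.app t.wk (.var .z)))) =
      Fm.all σ' (.imp (F' (θ σ') (.var .z)) (G' (θ σ') (.app t'.wk (.var .z)))) := by
  subst hσ hτ
  rw [eq_of_heq h, hF _ .rfl, hG _ .rfl]

theorem mrt_subst (A : Fm Γ) (s : Sub Γ Δ) (θ : Sub Δ Ξ) {t : Tm Ξ (A.subst s).rtype}
    {t' : Tm Ξ A.rtype} (h : t ≍ t') : mrt (A.subst s) θ t = mrt A (s.comp θ) t' := by
  induction A generalizing Δ Ξ with
  | eq => simp only [mrt, Fm.subst, Tm.subst_subst]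
  | bot => rfl
  | and A B ih₁ ih₂ =>
    have hA := A.rtype_subst s
    have hB := B.rtype_subst s
    exact congrArg₂ Fm.and (ih₁ s θ (Tm.fst_heq hA hB h)) (ih₂ s θ (Tm.snd_heq hA hB h))
  | or A B ih₁ ih₂ =>
    have hA := A.rtype_subst s
    have hB := B.rtype_subst s
    have h_fst := Tm.fst_heq (congrArg₂ Ty.prod hA hB) rfl h
    have h_snd := eq_of_heq (Tm.snd_heq (congrArg₂ Ty.prod hA hB) rfl h)
    exact congrArg₂ Fm.and
      (congrArg₂ Fm.imp (congrArg (Fm.eq · _) h_snd) (ih₁ s θ (Tm.fst_heq hA hB h_fst)))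
      (congrArg₂ Fm.imp (congrArg (Fm.eq · _ |>.neg) h_snd) (ih₂ s θ (Tm.snd_heq hA hB h_fst)))
  | imp A B ih₁ ih₂ =>
    refine congrArg₂ Fm.and ?_ (congrArg₂ Fm.imp (A.subst_subst s θ) (B.subst_subst s θ))
    simp only [← Sub.comp_wk]
    exact Fm.all_imp_congr_of_heq (A.rtype_subst s) (B.rtype_subst s) (ih₁ s) (ih₂ s) h
  | all σ A ih =>
    rw [mrt, Sub.lift_comp, ← ih _ _ (Tm.app_wk_heq (A.rtype_subst _) h)]
    rfl
  | ex σ A ih =>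
    have hA := A.rtype_subst (s.lift σ)
    rw [mrt, ← eq_of_heq (Tm.snd_heq hA rfl h), ← Sub.lift_comp_cons,
      ← ih _ _ (Tm.fst_heq hA rfl h)]
    rfl

/-! ### Realizability implies truth -/

theorem Prf.decide_elim (C : Fm (Ty.nat :: Δ)) (n : Tm Δ Ty.nat)
    (hA : Prf R L (.imp (.eq n .zero) A)) (hB : Prf R L (.imp (Fm.eq n .zero).neg B))
    (h₀ : Prf R L (.imp A (C.inst .zero)))
    (h₁ : Prf R (L.map (Fm.wk Ty.nat)) (.imp (B.wk _) C.atSucc)) : Prf R L (C.inst n) := by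
  let D : Fm (Ty.nat :: Δ) := .imp (.imp (.eq (.var .z) .zero) (A.wk _))
    (.imp (.imp (Fm.eq (.var .z) .zero).neg (B.wk _)) C)
  have inst_D (u : Tm Δ Ty.nat) : D.inst u = .imp (.imp (.eq u .zero) A)
      (.imp (.imp (Fm.eq u .zero).neg B) (C.inst u)) := by
    simp only [D, Fm.inst, Fm.subst, Fm.neg, Tm.subst, Fm.subst_cons_wk, Sub.cons, Fm.subst_id]
  have atSucc_D : D.atSucc = .imp (.imp (.eq (.succ (.var .z)) .zero) (A.wk _))
      (.imp (.imp (Fm.eq (.succ (.var .z)) .zero).neg (B.wk _)) C.atSucc) := by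
    simp only [D, Fm.atSucc, Fm.subst, Fm.neg, Tm.subst, Fm.subst_cons_wk, Sub.cons]; rfl
  have hD : Prf R L (D.inst n) := by
    refine .nat_cases D n ?_ ?_
    · rw [inst_D]
      refine .impI (.impI (.impE ((h₀.weaken_cons _).weaken_cons _) ?_))
      exact .impE (Prf.weaken_cons .hyp _) (.eqConv (.refl _))
    · rw [atSucc_D]
      exact .impI (.impI (.impE ((h₁.weaken_cons _).weaken_cons _) (.impE .hyp .succ_ne_zero)))
  rw [inst_D] at hD
  exact .impE (.impE hD hA) hB

theorem Prf.truth_of_mrt {A : Fm Γ} {s : Sub Γ Δ} {t : Tm Δ A.rtype}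
    (h : Prf R L (mrt A s t)) : Prf R L (A.subst s) := by
  induction A generalizing Δ with
  | eq => exact h
  | bot => exact h
  | and _ _ ih₁ ih₂ => exact .andI (ih₁ h.andE₁) (ih₂ h.andE₂)
  | or A B ih₁ ih₂ =>
    have h_or := Prf.decide_elim (((Fm.or A B).subst s).wk _) _ h.andE₁ h.andE₂
      (by rw [Fm.inst_wk]; exact .impI (.orI₁ (ih₁ .hyp)))
      (by
        rw [Fm.atSucc, Fm.subst_cons_wk]
        exact Prf.wk (A := .imp (mrt B s (.snd (.fst t))) ((Fm.or A B).subst s))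
          (.impI (.orI₂ (ih₂ .hyp))) _)
    rwa [Fm.inst_wk] at h_or
  | imp => exact h.andE₂
  | all _ _ ih => exact .allI (ih h.all_open)
  | ex _ A ih =>
    refine .exI t.snd ?_
    rw [Fm.inst_subst_lift]
    exact ih h

/-! ### Realizable formulas -/

theorem Tm.nonempty : ∀ (σ : Ty) (Δ : Ctx), Nonempty (Tm Δ σ)
  | .nat, _ => ⟨.zero⟩
  | .unit, _ => ⟨.star⟩
  | .prod σ τ, Δ => (Tm.nonempty σ Δ).elim fun t => (Tm.nonempty τ Δ).elim fun u => ⟨.pair t u⟩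
  | .arr σ τ, Δ => (Tm.nonempty τ (σ :: Δ)).elim fun t => ⟨.lam t⟩

/-- The assumptions `L` together with the assumption that a fresh variable realizes `A[s]`;
this is how `mrtCtx` extends a list of assumptions by `A`. -/
def mrtCons (A : Fm Γ) (s : Sub Γ Δ) (L : List (Fm Δ)) : List (Fm (A.rtype :: Δ)) :=
  mrt A (s.wk A.rtype) (.var .z) :: L.map (Fm.wk A.rtype)

theorem Prf.imp_mrt_inst {Γ' : Ctx} {A : Fm Γ} {C : Fm Γ'} {s : Sub Γ Δ} {s' : Sub Γ' Δ}
    {c : Tm (A.rtype :: Δ) C.rtype} (h : Prf R (mrtCons A s L) (mrt C (s'.wk A.rtype) c))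
    (u : Tm Δ A.rtype) : Prf R L (.imp (mrt A s u) (mrt C s' (c.inst u))) := by
  rw [← inst_mrt_wk, show mrt A s u = (mrt A (s.wk A.rtype) (.var .z)).inst u from
    (inst_mrt_wk A s (.var .z) u).symm]
  exact .allE u (.allI (.impI h))

/-- The term `r(x)` defined from `a` and `t(x,y)` by the primitive recursion `r(0) = a`,
`r(S x) = t(x,r(x))`. -/
def Tm.recur (a : Tm Δ σ) (t : Tm (σ :: Ty.nat :: Δ) σ) : Tm (Ty.nat :: Δ) σ :=
  .natRec a.wk (Tm.wk (.lam (.lam t))) (.var .z)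

theorem Tm.recur_inst_zero (a : Tm Δ σ) (t : Tm (σ :: Ty.nat :: Δ) σ) :
    Conv ((Tm.recur a t).inst .zero) a := by
  simp only [Tm.recur, Tm.inst, Tm.subst, Tm.subst_cons_wk, Tm.subst_id, Sub.cons]
  exact .natRec_zero _ _

theorem Tm.recur_atSucc (a : Tm Δ σ) (t : Tm (σ :: Ty.nat :: Δ) σ) :
    Conv (Tm.recur a t).atSucc (t.inst (Tm.recur a t)) := by
  have wk_atSucc {ρ : Ty} (u : Tm Δ ρ) : u.wk.atSucc = u.wk := by
    rw [Tm.atSucc, Tm.subst_cons_wk, ← Tm.wk_eq_subst]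
  have h_eq : (Tm.recur a t).atSucc = .natRec a.wk (Tm.wk (.lam (.lam t))) (.succ (.var .z)) :=
    congrArg₂ (Tm.natRec · · (.succ (.var .z))) (wk_atSucc a) (wk_atSucc _)
  rw [h_eq]
  exact (Conv.natRec_succ _ _ _).trans
    ((Conv.app (.app_lam_wk _) (.refl _)).trans (.beta _ _))

/-- Under the assumptions `L`, some term provably realizes `A[s]`. -/
def Realizable (R : Set Ty) (L : List (Fm Δ)) (A : Fm Γ) (s : Sub Γ Δ) : Prop :=
  ∃ t, Prf R L (mrt A s t)

namespace Realizable

variable {s : Sub Γ Δ} {A B C : Fm Γ}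

theorem truth (h : Realizable R L A s) : Prf R L (A.subst s) :=
  h.elim fun _ => Prf.truth_of_mrt

theorem weaken (h : Realizable R L A s) (hL : L ⊆ L') : Realizable R L' A s :=
  h.imp fun _ h => h.weaken hL

theorem conv {s' : Sub Γ Δ} (h : Realizable R L A s) (hs : s.Convertible s') :
    Realizable R L A s' :=
  h.imp fun _ h => (mrt_equiv A hs (.refl _) L).1 h

theorem wk (h : Realizable R L A s) (τ : Ty) : Realizable R (L.map (Fm.wk τ)) A (s.wk τ) :=
  let ⟨t, h⟩ := h
  ⟨t.wk, wk_mrt A s t τ ▸ h.wk τ⟩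

theorem subst_iff {A : Fm Ξ} {θ : Sub Ξ Γ} :
    Realizable R L (A.subst θ) s ↔ Realizable R L A (θ.comp s) := by
  have hA := congrArg (Tm Δ) (A.rtype_subst θ)
  constructor
  · rintro ⟨t, h⟩
    exact ⟨cast hA t, mrt_subst A θ s (cast_heq hA t).symm ▸ h⟩
  · rintro ⟨t, h⟩
    exact ⟨cast hA.symm t, (mrt_subst A θ s (cast_heq hA.symm t)).symm ▸ h⟩

theorem inst_iff {A : Fm (τ :: Γ)} {u : Tm Γ τ} :
    Realizable R L (A.inst u) s ↔ Realizable R L A (Sub.cons (u.subst s) s) := by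
  rw [Fm.inst, subst_iff, Sub.cons_comp, Sub.id_comp]

theorem wk_iff {u : Tm Δ τ} :
    Realizable R L (A.wk τ) (Sub.cons u s) ↔ Realizable R L A s := by
  rw [Fm.wk, subst_iff, Sub.wk_comp_cons, Sub.id_comp]

theorem hyp : Realizable R (mrtCons A s L) A (s.wk A.rtype) := ⟨.var .z, .hyp⟩

theorem bot_elim (h : Prf R L .bot) : Realizable R L A s :=
  (Tm.nonempty A.rtype Δ).elim fun t => ⟨t, .botE h⟩

theorem and_intro (hA : Realizable R L A s) (hB : Realizable R L B s) :
    Realizable R L (.and A B) s :=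
  let ⟨t, ht⟩ := hA
  let ⟨u, hu⟩ := hB
  ⟨.pair t u, .andI (ht.mrt_conv (.symm (.fst_pair t u))) (hu.mrt_conv (.symm (.snd_pair t u)))⟩

theorem imp_intro (h : Realizable R (mrtCons A s L) B (s.wk A.rtype))
    (htruth : Prf R L ((Fm.imp A B).subst s)) : Realizable R L (.imp A B) s :=
  let ⟨t, ht⟩ := h
  ⟨.lam t, .andI (.allI (.impI (ht.mrt_conv (.symm (.app_lam_wk t))))) htruth⟩

theorem imp_elim (h : Realizable R L (.imp A B) s) (hA : Realizable R L A s) :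
    Realizable R L B s := by
  obtain ⟨t, ht⟩ := h
  obtain ⟨u, hu⟩ := hA
  have htu := Prf.allE u ht.andE₁
  rw [Fm.inst, Fm.subst, ← Fm.inst, ← Fm.inst, inst_mrt_wk, inst_mrt_wk] at htu
  exact ⟨_, .impE htu hu⟩

theorem neg_intro (h : Prf R L (A.neg.subst s)) : Realizable R L A.neg s := by
  refine imp_intro ⟨.star, ?_⟩ h
  have h_wk : Prf R (mrtCons A s L) ((A.subst (s.wk A.rtype)).neg) :=
    Prf.weaken_cons (Fm.subst_wk A s _ ▸ h.wk A.rtype) _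
  exact .impE h_wk hyp.truth

theorem all_intro {A : Fm (σ :: Γ)} (h : Realizable R (L.map (Fm.wk σ)) A (s.lift σ)) :
    Realizable R L (.all σ A) s :=
  let ⟨t, ht⟩ := h
  ⟨.lam t, .allI (ht.mrt_conv (.symm (.app_lam_wk t)))⟩

theorem all_elim {A : Fm (σ :: Γ)} (h : Realizable R L (.all σ A) s) (u : Tm Δ σ) :
    Realizable R L A (Sub.cons u s) := by
  obtain ⟨t, ht⟩ := h
  have htu := Prf.allE u ht
  rw [inst_mrt_lift] at htu
  exact ⟨_, htu⟩

theorem ex_intro {A : Fm (σ :: Γ)} (u : Tm Δ σ) (h : Realizable R L A (Sub.cons u s)) :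
    Realizable R L (.ex σ A) s :=
  let ⟨t, ht⟩ := h
  ⟨.pair t u, (mrt_equiv A (.cons (.symm (.snd_pair t u)) (.refl s))
    (.symm (.fst_pair t u)) L).1 ht⟩

theorem ex_elim {A : Fm (σ :: Γ)} (h : Realizable R L (.ex σ A) s) :
    ∃ u : Tm Δ σ, Realizable R L A (Sub.cons u s) :=
  let ⟨t, ht⟩ := h
  ⟨.snd t, .fst t, ht⟩

theorem or_intro_left (hA : Realizable R L A s) : Realizable R L (.or A B) s := by
  obtain ⟨t, ht⟩ := hA
  obtain ⟨u⟩ := Tm.nonempty B.rtype Δ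
  have ht' : Prf R L (mrt A s (.fst (.fst (.pair (.pair t u) .zero)))) :=
    ht.mrt_conv (.symm ((Conv.fst (.fst_pair _ _)).trans (.fst_pair t u)))
  exact ⟨.pair (.pair t u) .zero, .andI (.impI (ht'.weaken_cons _))
    (.impI (.botE (.impE .hyp (.eqConv (.snd_pair _ _)))))⟩

theorem or_intro_right (hB : Realizable R L B s) : Realizable R L (.or A B) s := by
  obtain ⟨t, ht⟩ := hB
  obtain ⟨u⟩ := Tm.nonempty A.rtype Δ
  have ht' : Prf R L (mrt B s (.snd (.fst (.pair (.pair u t) (.succ .zero))))) :=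
    ht.mrt_conv (.symm ((Conv.snd (.fst_pair _ _)).trans (.snd_pair u t)))
  exact ⟨.pair (.pair u t) (.succ .zero), .andI
    (.impI (.botE (.impE .succ_ne_zero (.eq_trans (.eqConv (.symm (.snd_pair _ _))) .hyp))))
    (.impI (ht'.weaken_cons _))⟩

theorem or_elim (h : Realizable R L (.or A B) s)
    (hA : Realizable R (mrtCons A s L) C (s.wk A.rtype))
    (hB : Realizable R (mrtCons B s L) C (s.wk B.rtype)) : Realizable R L C s := by
  obtain ⟨t, ht⟩ := h
  obtain ⟨a, ha⟩ := hA
  obtain ⟨b, hb⟩ := hB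
  let a' := a.inst (.fst (.fst t))
  let b' := b.inst (.snd (.fst t))
  have h₀ : Prf R L (.imp (mrt A s (.fst (.fst t))) (mrt C s a')) := ha.imp_mrt_inst _
  have h₁ : Prf R L (.imp (mrt B s (.snd (.fst t))) (mrt C s b')) := hb.imp_mrt_inst _
  -- Definition by cases on the decision `t.snd` is a recursion that ignores the previous value.
  let r : Tm (Ty.nat :: Δ) C.rtype := Tm.recur a' b'.wk.wk
  have hr : Prf R L ((mrt C (s.wk Ty.nat) r).inst (.snd t)) := by
    refine .decide_elim _ _ ht.andE₁ ht.andE₂ (.impI ?_) (.impI ?_)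
    · rw [inst_mrt_wk]
      exact (Prf.impE (h₀.weaken_cons _) .hyp).mrt_conv (Tm.recur_inst_zero _ _).symm
    · have hb' : Prf R ((mrt B s (.snd (.fst t))).wk Ty.nat :: L.map (Fm.wk Ty.nat))
          ((mrt C s b').wk Ty.nat) := .impE ((h₁.wk Ty.nat).weaken_cons _) .hyp
      have hr_succ : Conv r.atSucc b'.wk := Tm.inst_wk b'.wk r ▸ Tm.recur_atSucc _ _
      rw [wk_mrt C] at hb'
      rw [atSucc_mrt_wk]
      exact hb'.mrt_conv hr_succ.symm
  exact ⟨_, inst_mrt_wk C s r _ ▸ hr⟩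

theorem ind {A : Fm (Ty.nat :: Γ)} (h₀ : Realizable R L A (Sub.cons .zero s))
    (h₁ : Realizable R (L.map (Fm.wk Ty.nat)) (.imp A A.atSucc) (s.lift Ty.nat)) :
    Realizable R (L.map (Fm.wk Ty.nat)) A (s.lift Ty.nat) := by
  obtain ⟨a, ha⟩ := h₀
  obtain ⟨t, ht⟩ : Realizable R (mrtCons A (s.lift Ty.nat) (L.map (Fm.wk Ty.nat))) A
      ((Sub.cons (.succ (.var .z)) (s.wk Ty.nat)).wk A.rtype) := by
    have h_step := imp_elim ((h₁.wk A.rtype).weaken (List.subset_cons_self _ _)) hyp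
    rw [Fm.atSucc, subst_iff, Sub.comp_wk, Sub.cons_comp, Sub.wk_comp_lift,
      Sub.id_comp] at h_step
    exact h_step
  refine ⟨Tm.recur a t, Prf.all_open (.ind _ ?_ (.allI (.impI ?_)))⟩
  · rw [inst_mrt_lift]
    exact ha.mrt_conv (Tm.recur_inst_zero a t).symm
  · rw [atSucc_mrt_lift]
    exact (Prf.impE ((ht.imp_mrt_inst _).weaken_cons _) .hyp).mrt_conv
      (Tm.recur_atSucc a t).symm

theorem eq_subst {A : Fm (Ty.nat :: Γ)} {t u : Tm Δ Ty.nat} (h : Prf R L (.eq t u))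
    (hA : Realizable R L A (Sub.cons t s)) : Realizable R L A (Sub.cons u s) := by
  obtain ⟨r, hr⟩ := hA
  have inst_mrt (w : Tm Δ Ty.nat) :
      (mrt A (s.lift Ty.nat) r.wk).inst w = mrt A (Sub.cons w s) r := by
    rw [inst_mrt_lift, Tm.inst_wk]
  exact ⟨r, inst_mrt u ▸ .eqSubst _ h (inst_mrt t ▸ hr)⟩

/-- A realizer of `∀ x ∃ y A(x,y)` yields, for every `x`, a pair of a realizer and a witness `y`,
so the choice function is read off the realizer of the premise. -/
theorem ac (hρ : ρ ∈ R) (A : Fm (σ :: ρ :: Γ)) : Realizable R L (ac ρ σ A) s := by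
  refine imp_intro ?_ (ac_subst A s ▸ .ac σ _ hρ)
  obtain ⟨f, hf⟩ := hyp (R := R) (A := .all ρ (.ex σ A)) (s := s) (L := L)
  refine ex_intro (.lam (.snd (.app f.wk (.var .z)))) (all_intro ?_)
  rw [Fm.atApp, subst_iff]
  refine .conv ⟨_, hf.all_open⟩ ?_
  simp only [Sub.cons_comp, Tm.subst, Sub.wk_comp_lift, Sub.wk_comp_cons, Sub.id_comp]
  exact .cons (.symm (.app_lam_wk _)) (.refl _)

/-- A negation is realized as soon as it is true, so the double-negation shift is realized because
the theory itself proves it. -/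
theorem dns (hρ : ρ ∈ R) (A : Fm (ρ :: Γ)) : Realizable R L (dns ρ A) s :=
  imp_intro (neg_intro (.impE (.dns _ hρ) hyp.truth)) (.dns _ hρ)

end Realizable

/-! ### Soundness -/

theorem realizable_cons {L : List (Fm Γ)} {s : Sub Γ Δ} {L' : List (Fm Δ)}
    (hL : ∀ B ∈ L, Realizable R L' B s) (A : Fm Γ) :
    ∀ B ∈ A :: L, Realizable R (mrtCons A s L') B (s.wk A.rtype) :=
  List.forall_mem_cons.2
    ⟨.hyp, fun B hB => ((hL B hB).wk _).weaken (List.subset_cons_self _ _)⟩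

theorem realizable_map_wk {L : List (Fm Γ)} {s : Sub Γ Δ} {L' : List (Fm Δ)}
    (hL : ∀ B ∈ L, Realizable R L' B s) (u : Tm Δ τ) :
    ∀ B ∈ L.map (Fm.wk τ), Realizable R L' B (Sub.cons u s) :=
  List.forall_mem_map.2 fun B hB => Realizable.wk_iff.2 (hL B hB)

theorem Prf.subst_of_realizable {L : List (Fm Γ)} {A : Fm Γ} (h : Prf R L A) {s : Sub Γ Δ}
    {L' : List (Fm Δ)} (hL : ∀ B ∈ L, Realizable R L' B s) : Prf R L' (A.subst s) :=
  (h.subst s).cut (List.forall_mem_map.2 fun B hB => (hL B hB).truth)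

theorem Prf.realizable {L : List (Fm Γ)} {A : Fm Γ} (h : Prf R L A) {s : Sub Γ Δ}
    {L' : List (Fm Δ)} (hL : ∀ B ∈ L, Realizable R L' B s) : Realizable R L' A s := by
  induction h generalizing Δ with
  | ax h => exact hL _ h
  | andI _ _ ih₁ ih₂ => exact .and_intro (ih₁ hL) (ih₂ hL)
  | andE₁ _ ih => exact (ih hL).elim fun t h => ⟨.fst t, h.andE₁⟩
  | andE₂ _ ih => exact (ih hL).elim fun t h => ⟨.snd t, h.andE₂⟩
  | orI₁ _ ih => exact .or_intro_left (ih hL)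
  | orI₂ _ ih => exact .or_intro_right (ih hL)
  | orE _ _ _ ih ih₁ ih₂ =>
    exact .or_elim (ih hL) (ih₁ (realizable_cons hL _)) (ih₂ (realizable_cons hL _))
  | impI h ih =>
    exact .imp_intro (ih (realizable_cons hL _)) ((Prf.impI h).subst_of_realizable hL)
  | impE _ _ ih₁ ih₂ => exact .imp_elim (ih₁ hL) (ih₂ hL)
  | botE _ ih => exact .bot_elim (ih hL).truth
  | allI _ ih => exact .all_intro (ih (realizable_map_wk (fun B hB => (hL B hB).wk _) _))
  | allE t _ ih => exact Realizable.inst_iff.2 ((ih hL).all_elim _)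
  | exI t _ ih => exact .ex_intro _ (Realizable.inst_iff.1 (ih hL))
  | exE _ _ ih₁ ih₂ =>
    obtain ⟨u, hu⟩ := (ih₁ hL).ex_elim
    exact Realizable.wk_iff.1 (ih₂ (List.forall_mem_cons.2 ⟨hu, realizable_map_wk hL u⟩))
  | eqConv h => exact ⟨.star, .eqConv (h.subst s)⟩
  | eqSubst A _ _ ih₁ ih₂ =>
    exact Realizable.inst_iff.2 (.eq_subst (ih₁ hL).truth (Realizable.inst_iff.1 (ih₂ hL)))
  | succ_inj _ ih => exact ⟨.star, .succ_inj (ih hL).truth⟩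
  | succ_ne_zero => exact .neg_intro .succ_ne_zero
  | ind A _ _ ih₁ ih₂ =>
    have h_step := ((ih₂ hL).wk Ty.nat).all_elim (.var .z)
    exact .all_intro (.ind (Realizable.inst_iff.1 (ih₁ hL)) h_step)
  | ac σ A h => exact .ac h A
  | dns A h => exact .dns h A

theorem realizable_mrtCtx (L : List (Fm Δ)) :
    ∀ B ∈ L, Realizable R (mrtCtx L) B (realWk L) := by
  induction L with
  | nil => exact List.forall_mem_nil _
  | cons A L ih => exact realizable_cons ih A

theorem Prf.existence {A : Fm (τ :: Δ)} (h : Prf R L (.ex τ A)) :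
    ∃ t : Tm (realCtx L) τ, Prf R (mrtCtx L) (A.subst (Sub.cons t (realWk L))) :=
  (h.realizable (realizable_mrtCtx L)).ex_elim.imp fun _ => Realizable.truth

/-! ### Terms denote recursive functions -/

open Nat.Partrec (Code)

/-- Kleene application: the value at `a` of the partial recursive function with index `c`. -/
def kleeneApp (c a : ℕ) : Part ℕ := (Denumerable.ofNat Code c).eval a

/-- The `k`-th iterate, starting from `x`, of the partial recursive operation with index `c`
(which takes the step number and the previous value as curried arguments). -/
def kleeneRec (c x k : ℕ) : Part ℕ :=
  k.rec (Part.some x) fun i ih => ih.bind fun v => (kleeneApp c i).bind fun d => kleeneApp d v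

section

variable {α : Type*} [Primcodable α]

theorem partrec_kleeneApp {f g : α → ℕ} (hf : Computable f) (hg : Computable g) :
    Partrec fun a => kleeneApp (f a) (g a) :=
  Code.eval_part.comp ((Computable.ofNat Code).comp hf) hg

theorem partrec_kleeneRec {f g h : α → ℕ} (hf : Computable f) (hg : Computable g)
    (hh : Computable h) : Partrec fun a => kleeneRec (f a) (g a) (h a) := by
  have h_outer : Partrec fun p : α × ℕ × ℕ => kleeneApp (f p.1) p.2.1 :=
    partrec_kleeneApp (hf.comp Computable.fst) (Computable.fst.comp Computable.snd)
  have h_inner : Partrec₂ fun (p : α × ℕ × ℕ) d => kleeneApp d p.2.2 :=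
    partrec_kleeneApp Computable.snd (Computable.snd.comp (Computable.snd.comp Computable.fst))
  have h_step : Partrec₂ fun a (p : ℕ × ℕ) => (kleeneApp (f a) p.1).bind (kleeneApp · p.2) :=
    h_outer.bind h_inner
  exact Partrec.nat_rec hh hg.partrec h_step

theorem exists_kleeneApp_eq {F : ℕ →. ℕ} (hF : Partrec F) :
    ∃ g : ℕ → ℕ, Computable g ∧ ∀ e a, kleeneApp (g e) a = F (Nat.pair e a) := by
  obtain ⟨c, rfl⟩ := Code.exists_code.1 (Partrec.nat_iff.1 hF)
  refine ⟨fun e => Encodable.encode (c.curry e), Computable.encode.comp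
    (Code.primrec₂_curry.to_comp.comp (Computable.const c) Computable.id), fun e a => ?_⟩
  rw [kleeneApp, Denumerable.ofNat_encode, Code.eval_curry]

end

/-- The number `n` codes the closed term `t` hereditarily: as its value at type `0`, and as an
index of a partial recursive function that maps codes to codes at arrow types. -/
def Computes : (σ : Ty) → Tm [] σ → ℕ → Prop
  | .nat, t, n => Conv t (num n)
  | .unit, _, _ => True
  | .prod σ τ, t, n => Computes σ (.fst t) n.unpair.1 ∧ Computes τ (.snd t) n.unpair.2
  | .arr σ τ, t, n => ∀ u a, Computes σ u a → ∃ b ∈ kleeneApp n a, Computes τ (.app t u) b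

theorem Computes.conv : ∀ {σ : Ty} {t u : Tm [] σ} {n : ℕ}, Computes σ t n → Conv t u →
    Computes σ u n
  | .nat, _, _, _, h, htu => htu.symm.trans h
  | .unit, _, _, _, _, _ => trivial
  | .prod _ _, _, _, _, h, htu => ⟨h.1.conv htu.fst, h.2.conv htu.snd⟩
  | .arr _ _, _, _, _, h, htu => fun v a ha =>
    (h v a ha).imp fun _ h => ⟨h.1, h.2.conv (htu.app (.refl v))⟩

theorem Computes.natRec {a : Tm [] σ} {f : Tm [] (.arr .nat (.arr σ σ))} {x c : ℕ}
    (ha : Computes σ a x) (hf : Computes _ f c) (k : ℕ) :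
    ∃ b ∈ kleeneRec c x k, Computes σ (.natRec a f (num k)) b := by
  induction k with
  | zero => exact ⟨x, Part.mem_some _, ha.conv (.symm (.natRec_zero _ _))⟩
  | succ k ih =>
    obtain ⟨v, hv, hvk⟩ := ih
    obtain ⟨d, hd, hdf⟩ := hf (num k) k (.refl _)
    obtain ⟨b, hb, hbf⟩ := hdf _ v hvk
    exact ⟨b, Part.mem_bind hv (Part.mem_bind hd hb), hbf.conv (.symm (.natRec_succ _ _ _))⟩

/-- The number `e` codes a sequence of codes of the values of the closed substitution `s`. -/
def ComputesSub : (Δ : Ctx) → Sub Δ [] → ℕ → Prop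
  | [], _, _ => True
  | τ :: Δ, s, e =>
    ComputesSub Δ (fun _ x => s _ x.s) e.unpair.1 ∧ Computes τ (s _ .z) e.unpair.2

theorem ComputesSub.cons {s : Sub Δ []} {e : ℕ} {u : Tm [] τ} {a : ℕ}
    (hs : ComputesSub Δ s e) (hu : Computes τ u a) :
    ComputesSub (τ :: Δ) (Sub.cons u s) (Nat.pair e a) := by
  rw [ComputesSub, Nat.unpair_pair]
  exact ⟨hs, hu⟩

/-- A term is tracked if a partial recursive function computes a code of each of its closed
instances from a code of the instantiating substitution. -/
def Tm.Tracked (t : Tm Δ σ) : Prop :=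
  ∃ F : ℕ →. ℕ, Partrec F ∧ ∀ s e, ComputesSub Δ s e → ∃ b ∈ F e, Computes σ (t.subst s) b

namespace Tm.Tracked

theorem of_computable {t : Tm Δ σ} {g : ℕ → ℕ} (hg : Computable g)
    (h : ∀ s e, ComputesSub Δ s e → Computes σ (t.subst s) (g e)) : t.Tracked :=
  ⟨_, hg.partrec, fun s e hs => ⟨_, Part.mem_some _, h s e hs⟩⟩

theorem map {t : Tm Δ σ} {u : Tm Δ τ} {g : ℕ → ℕ} (hg : Computable g)
    (h : ∀ s n, Computes σ (t.subst s) n → Computes τ (u.subst s) (g n)) (ht : t.Tracked) :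
    u.Tracked := by
  obtain ⟨F, hF, hFt⟩ := ht
  refine ⟨_, hF.map (hg.comp Computable.snd).to₂, fun s e hs => ?_⟩
  obtain ⟨n, hn, hnt⟩ := hFt s e hs
  exact ⟨_, Part.mem_map _ hn, h s n hnt⟩

theorem bind₂ {t : Tm Δ σ} {u : Tm Δ τ} {v : Tm Δ ρ} {g : ℕ → ℕ → Part ℕ}
    (hg : Partrec₂ g) (h : ∀ s m n, Computes σ (t.subst s) m → Computes τ (u.subst s) n →
      ∃ b ∈ g m n, Computes ρ (v.subst s) b) (ht : t.Tracked) (hu : u.Tracked) :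
    v.Tracked := by
  obtain ⟨F, hF, hFt⟩ := ht
  obtain ⟨G, hG, hGu⟩ := hu
  refine ⟨fun e => (F e).bind fun m => (G e).bind (g m), hF.bind ((hG.comp Computable.fst).bind
    (hg.comp (Computable.snd.comp Computable.fst) Computable.snd)), fun s e hs => ?_⟩
  obtain ⟨m, hm, hmt⟩ := hFt s e hs
  obtain ⟨n, hn, hnu⟩ := hGu s e hs
  obtain ⟨b, hb, hbv⟩ := h s m n hmt hnu
  exact ⟨b, Part.mem_bind hm (Part.mem_bind hn hb), hbv⟩

theorem var (x : Var Δ σ) : (Tm.var x).Tracked := by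
  suffices h : ∃ g : ℕ → ℕ, Computable g ∧
      ∀ s e, ComputesSub Δ s e → Computes σ (s _ x) (g e) from
    let ⟨_, hg, hgx⟩ := h
    of_computable hg hgx
  induction x with
  | z => exact ⟨_, Computable.snd.comp Computable.unpair, fun s e hs => hs.2⟩
  | s x ih =>
    obtain ⟨g, hg, hgx⟩ := ih
    exact ⟨_, hg.comp (Computable.fst.comp Computable.unpair), fun s e hs => hgx _ _ hs.1⟩

theorem lam {t : Tm (σ :: Δ) τ} (ht : t.Tracked) : (Tm.lam t).Tracked := by
  obtain ⟨F, hF, hFt⟩ := ht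
  obtain ⟨g, hg, hgF⟩ := exists_kleeneApp_eq hF
  refine of_computable hg fun s e hs u a ha => ?_
  obtain ⟨b, hb, hbt⟩ := hFt (Sub.cons u s) (Nat.pair e a) (hs.cons ha)
  have hβ : Conv (.app ((Tm.lam t).subst s) u) (t.subst (Sub.cons u s)) :=
    (Conv.beta _ _).trans (.of_eq (Tm.inst_subst_lift t s u))
  exact ⟨b, hgF e a ▸ hb, hbt.conv hβ.symm⟩

theorem app {t : Tm Δ (.arr σ τ)} {u : Tm Δ σ} : t.Tracked → u.Tracked →
    (Tm.app t u).Tracked :=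
  bind₂ (partrec_kleeneApp Computable.fst Computable.snd) fun _ _ n ht hu => ht _ n hu

theorem pair {t : Tm Δ σ} {u : Tm Δ τ} : t.Tracked → u.Tracked → (Tm.pair t u).Tracked := by
  refine bind₂ (g := fun m n => Part.some (Nat.pair m n))
    Primrec₂.natPair.to_comp.partrec₂ fun s m n ht hu => ⟨_, Part.mem_some _, ?_⟩
  rw [Computes, Nat.unpair_pair]
  exact ⟨ht.conv (.symm (.fst_pair _ _)), hu.conv (.symm (.snd_pair _ _))⟩

theorem fst {t : Tm Δ (.prod σ τ)} : t.Tracked → (Tm.fst t).Tracked :=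
  map (Computable.fst.comp Computable.unpair) fun _ _ h => h.1

theorem snd {t : Tm Δ (.prod σ τ)} : t.Tracked → (Tm.snd t).Tracked :=
  map (Computable.snd.comp Computable.unpair) fun _ _ h => h.2

theorem succ {t : Tm Δ .nat} : t.Tracked → (Tm.succ t).Tracked :=
  map Computable.succ fun _ _ h => Conv.succ h

theorem natRec {a : Tm Δ σ} {f : Tm Δ (.arr .nat (.arr σ σ))} {n : Tm Δ .nat}
    (ha : a.Tracked) (hf : f.Tracked) (hn : n.Tracked) : (Tm.natRec a f n).Tracked := by
  have h_pair : (Tm.pair a f).Tracked := ha.pair hf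
  refine bind₂ (g := fun p k => kleeneRec p.unpair.2 p.unpair.1 k)
    (partrec_kleeneRec (Computable.snd.comp (Computable.unpair.comp Computable.fst))
      (Computable.fst.comp (Computable.unpair.comp Computable.fst)) Computable.snd)
    (fun s p k hp hk => ?_) h_pair hn
  obtain ⟨b, hb, hbk⟩ := (hp.1.conv (.fst_pair _ _)).natRec (hp.2.conv (.snd_pair _ _)) k
  exact ⟨b, hb, hbk.conv (.natRec (.refl _) (.refl _) (.symm hk))⟩

end Tm.Tracked

theorem Tm.tracked (t : Tm Δ σ) : t.Tracked := by
  induction t with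
  | var x => exact .var x
  | lam _ ih => exact ih.lam
  | app _ _ iht ihu => exact iht.app ihu
  | pair _ _ iht ihu => exact iht.pair ihu
  | fst _ ih => exact ih.fst
  | snd _ ih => exact ih.snd
  | star => exact .of_computable (Computable.const 0) fun _ _ _ => trivial
  | zero => exact .of_computable (Computable.const 0) fun _ _ _ => Conv.refl .zero
  | succ _ ih => exact ih.succ
  | natRec _ _ _ iha ihf ihn => exact iha.natRec ihf ihn

theorem Tm.exists_computable (t : Tm [Ty.nat] Ty.nat) : ∃ f : ℕ → ℕ, Computable f ∧
    ∀ n, Conv (t.inst (num n)) (num (f n)) := by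
  obtain ⟨F, hF, hFt⟩ := t.tracked
  have computesSub_num (n : ℕ) :
      ComputesSub [Ty.nat] (Sub.cons (num n) (Sub.id [])) (Nat.pair 0 n) :=
    ComputesSub.cons (Δ := []) trivial (Conv.refl (num n))
  choose f hf hft using fun n => hFt _ _ (computesSub_num n)
  have hF_pair : Partrec fun n => F (Nat.pair 0 n) :=
    hF.comp (Primrec₂.natPair.to_comp.comp (Computable.const 0) Computable.id)
  exact ⟨f, hF_pair.of_eq fun n => Part.eq_some_iff.2 (hf n), hft⟩

theorem Tm.exists_conv_num (t : Tm [] Ty.nat) : ∃ n, Conv t (num n) := by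
  obtain ⟨f, -, hf⟩ := (t.wk : Tm [Ty.nat] Ty.nat).exists_computable
  exact ⟨f 0, Tm.inst_wk t (num 0) ▸ hf 0⟩

/-! ### Explicit definability for closed formulas -/

theorem Prf.exists_num {A : Fm [Ty.nat]} (h : Prf R [] (.ex Ty.nat A)) :
    ∃ n : ℕ, Prf R [] (A.inst (num n)) := by
  obtain ⟨t, ht⟩ := h.existence
  obtain ⟨n, hn⟩ := t.exists_conv_num
  exact ⟨n, Prf.inst_conv ht hn⟩

theorem Prf.disjunction {A B : Fm []} (h : Prf R [] (.or A B)) : Prf R [] A ∨ Prf R [] B := by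
  obtain ⟨t, ht⟩ := h.realizable (realizable_mrtCtx [])
  obtain ⟨n, hn⟩ := (Tm.snd t).exists_conv_num
  cases n with
  | zero => exact .inl (A.subst_id ▸ truth_of_mrt (.impE ht.andE₁ (.eqConv hn)))
  | succ n =>
    have snd_ne_zero : Prf R [] (Fm.eq (.snd t) .zero).neg :=
      .impI (.impE .succ_ne_zero (.eq_trans (.eqConv hn.symm) .hyp))
    exact .inr (B.subst_id ▸ truth_of_mrt (.impE ht.andE₂ snd_ne_zero))

theorem Prf.exists_computable_choice {A : Fm [Ty.nat, Ty.nat]}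
    (h : Prf R [] (.all Ty.nat (.ex Ty.nat A))) : ∃ f : ℕ → ℕ, Computable f ∧
      ∀ n : ℕ, Prf R [] ((A.inst (num (f n))).inst (num n)) := by
  obtain ⟨t, ht⟩ : ∃ t : Tm [Ty.nat] Ty.nat, Prf R [] (A.inst t) := h.all_open.existence
  obtain ⟨f, hf, hft⟩ := t.exists_computable
  refine ⟨f, hf, fun n => ?_⟩
  have h_inst : Prf R [] ((A.inst t).inst (num n)) := ht.subst (Sub.cons (num n) (Sub.id []))
  rw [Fm.inst, Fm.subst_inst] at h_inst ⊢
  rw [num_subst]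
  exact h_inst.inst_conv (hft n)

end HAOmega

theorem mainTheorem3_general (R : Set Ty) :
    (∀ (Δ : Ctx) (Γ : List (Fm Δ)) (τ : Ty) (A : Fm (τ :: Δ)),
      Prf R Γ (.ex τ A) →
        ∃ t : Tm (realCtx Γ) τ, Prf R (mrtCtx Γ) (A.subst (Sub.cons t (realWk Γ)))) ∧
    (∀ A : Fm [Ty.nat], Prf R [] (.ex Ty.nat A) → ∃ n : ℕ, Prf R [] (A.inst (num n))) ∧
    (∀ A B : Fm [], Prf R [] (.or A B) → Prf R [] A ∨ Prf R [] B) ∧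
    (∀ A : Fm [Ty.nat, Ty.nat], Prf R [] (.all Ty.nat (.ex Ty.nat A)) →
      ∃ f : ℕ → ℕ, Computable f ∧
        ∀ n : ℕ, Prf R [] ((A.inst (num (f n))).inst (num n))) :=
  ⟨fun _ _ _ _ h => h.existence, fun _ h => h.exists_num, fun _ _ h => h.disjunction,
    fun _ h => h.exists_computable_choice⟩

theorem mainTheorem3 (R : Set Ty) (hR : R = Set.univ ∨ R = {Ty.nat}) :
    -- Existence Property
    (∀ (Δ : Ctx) (Γ : List (Fm Δ)) (τ : Ty) (A : Fm (τ :: Δ)),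
      Prf R Γ (.ex τ A) →
        ∃ t : Tm (realCtx Γ) τ, Prf R (mrtCtx Γ) (A.subst (Sub.cons t (realWk Γ)))) ∧
    -- Existence Property for closed arithmetical formulas
    (∀ A : Fm [Ty.nat], A.Arithmetical → Prf R [] (.ex Ty.nat A) →
      ∃ n : ℕ, Prf R [] (A.inst (num n))) ∧
    -- Disjunction Property for closed arithmetical formulas
    (∀ A B : Fm [], A.Arithmetical → B.Arithmetical → Prf R [] (.or A B) →
      Prf R [] A ∨ Prf R [] B) ∧
    -- Weak Church Rule for closed arithmetical formulas
    (∀ A : Fm [Ty.nat, Ty.nat], A.Arithmetical →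
      Prf R [] (.all Ty.nat (.ex Ty.nat A)) →
        ∃ f : ℕ → ℕ, Computable f ∧
          ∀ n : ℕ, Prf R [] ((A.inst (num (f n))).inst (num n))) :=
  have ⟨ep, ep₀, dp₀, wcr₀⟩ := mainTheorem3_general R
  ⟨ep, fun A _ => ep₀ A, fun A B _ _ => dp₀ A B, fun A _ => wcr₀ A⟩
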